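/- **Setting.** Let $\Sigma$ be a root system of type $E_7$ with Weyl group $W$, acting on subsets of $\Sigma$, and write $(\alpha|\beta)=2(\alpha,\beta)/(\beta,\beta)$. A *$\Pi$-system* is a basis (set of simple roots) of a root subsystem of $\Sigma$. Two subsets of $\Sigma$ are *conjugate* if an element of $W$ maps one onto the other, and *isomorphic* if there is a bijection between them preserving $(\cdot|\cdot)$. A $\Pi$-system is *normal* if every $\Pi$-system isomorphic to it is conjugate to it, and *special* otherwise; a $W$-orbit of $\Pi$-systems is special if its elements are special. A *moset* in a set of roots $X$ is an orthogonal subset $O\subset X$ such that no element of $X\setminus O$ is orthogonal to $O$. A moset $O$ of an irreducible $X$ (one with connected diagram) is *perfect* if $X\setminus O$ is orthogonal and $|O|\ge|X\setminus O|$; a perfect moset of an arbitrary $X$ is a union of perfect mosets, one of each irreducible component of $X$. The *charge* of a $\Pi$-system is the cardinality of its perfect mosets. Let $\alpha_1,\dots,\alpha_7$ be simple roots of $\Sigma$ in Bourbaki's numbering. The roots $$\alpha_2,\quad \alpha_3,\quad \alpha_5,\quad \alpha_7,\quad \alpha_2+\alpha_3+2\alpha_4+\alpha_5,\quad \alpha_2+\alpha_3+2\alpha_4+2\alpha_5+2\alpha_6+\alpha_7,\quad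 2\alpha_1+2\alpha_2+3\alpha_3+4\alpha_4+3\alpha_5+2\alpha_6+\alpha_7$$ form a moset $M$ in $\Sigma$. Label them, in this order, by the nonzero vectors $001,100,010,011,111,110,101$ of $\mathbb F_2^3$. The *parity* of a subset of $M$ is $0$ if its labels sum to the zero vector and $1$ otherwise. The parity of an orthogonal set $O\subset\Sigma$ is the parity of any subset of $M$ conjugate to $O$, and the *parity* of a $\Pi$-system is the parity of its perfect mosets. (For the $\Pi$-systems below, that charge and parity are well defined is part of the claim.) **Theorem.** In $E_7$, every special $W$-orbit of $\Pi$-systems either is of one of the types $$A_5,\qquad A_3+A_1,\qquad 3A_1$$ and has charge $3$, or is of one of the types $$A_5+A_1,\qquad A_3+2A_1,\qquad 4A_1$$ and has charge $4$. For each of these six types, the $\Pi$-systems of that type form exactly two $W$-orbits: one with parity $0$ and the other with parity $1$. -/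

import Mathlib

namespace PiSystems

/-! ### Subsets of a root system

Sets of roots are given as sets of indices `Λ : Set ι` of a root pairing `P`. The number written
`(α | β) = 2 (α, β) / (β, β)` is `P.pairing i j` for `α = P.root i`, `β = P.root j`. -/

section General

variable {ι M N : Type*} [AddCommGroup M] [Module ℝ M] [AddCommGroup N] [Module ℝ N]
variable (P : RootPairing ι ℝ M N)

/-- `Ψ` is a root subsystem: it is stable under the reflections in its own elements. -/
def IsSubsystem (Ψ : Set ι) : Prop :=
  ∀ i ∈ Ψ, ∀ j ∈ Ψ, P.reflectionPerm i j ∈ Ψ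

/-- `Λ` is a basis (a set of simple roots) of `Ψ`: it is a linearly independent subset of `Ψ`, and
each element of `Ψ` is a combination of elements of `Λ` with coefficients that are all
non-negative integers or all non-positive integers. -/
def IsBasisOf (Λ Ψ : Set ι) : Prop :=
  Λ ⊆ Ψ ∧ LinearIndepOn ℝ P.root Λ ∧
    ∀ i ∈ Ψ, P.root i ∈ AddSubmonoid.closure (P.root '' Λ) ∨
      -P.root i ∈ AddSubmonoid.closure (P.root '' Λ)

/-- A `Π`-system is a basis of some root subsystem. -/
def IsPiSystem (Λ : Set ι) : Prop :=
  ∃ Ψ : Set ι, IsSubsystem P Ψ ∧ IsBasisOf P Λ Ψ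

/-- `Λ` and `Λ'` are conjugate: some element of the Weyl group maps `Λ` onto `Λ'`. -/
def Conj (Λ Λ' : Set ι) : Prop :=
  ∃ w : P.weylGroup, P.weylGroupToPerm w '' Λ = Λ'

/-- `Λ` and `Λ'` are isomorphic: some bijection between them preserves `(· | ·)`. -/
def Iso (Λ Λ' : Set ι) : Prop :=
  ∃ f : Λ ≃ Λ', ∀ i j : Λ, P.pairing (f i) (f j) = P.pairing i j

/-- A `Π`-system is normal if every `Π`-system isomorphic to it is conjugate to it. -/
def IsNormal (Λ : Set ι) : Prop :=
  IsPiSystem P Λ ∧ ∀ Λ' : Set ι, IsPiSystem P Λ' → Iso P Λ Λ' → Conj P Λ Λ'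

/-- A `Π`-system is special if it is not normal. -/
def IsSpecial (Λ : Set ι) : Prop :=
  IsPiSystem P Λ ∧ ¬ IsNormal P Λ

/-- The Cartan matrix of type `A_{n₁} + A_{n₂} + ⋯ + A_{nᵣ}`, for `t = [n₁, n₂, …, nᵣ]`. -/
def sumA (t : List ℕ) :
    Matrix (Σ k : Fin t.length, Fin (t.get k)) (Σ k : Fin t.length, Fin (t.get k)) ℤ :=
  Matrix.blockDiagonal' fun k => CartanMatrix.A (t.get k)

/-- `Λ` has type `A_{n₁} + A_{n₂} + ⋯ + A_{nᵣ}`, for `t = [n₁, n₂, …, nᵣ]`. -/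
def HasType (Λ : Set ι) (t : List ℕ) : Prop :=
  ∃ f : (Σ k : Fin t.length, Fin (t.get k)) ≃ Λ,
    ∀ x y, P.pairing (f x) (f y) = (sumA t x y : ℝ)

/-- The set of the Weyl orbits of the `Π`-systems of type `A_{n₁} + A_{n₂} + ⋯ + A_{nᵣ}`. -/
def orbitsOfType (t : List ℕ) : Set (Set (Set ι)) :=
  {Ω | ∃ Λ : Set ι, IsPiSystem P Λ ∧ HasType P Λ t ∧ Ω = {Λ' | Conj P Λ Λ'}}

/-- The diagram on all roots (multiplicities of bonds forgotten): two different roots are joined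
when they are not orthogonal. -/
def diagram : SimpleGraph ι :=
  SimpleGraph.fromRel fun i j => ¬ P.IsOrthogonal i j

/-- `C` is an irreducible component of `X`: a maximal subset of `X` with a connected diagram. -/
def IsComponent (C X : Set ι) : Prop :=
  Maximal (fun D : Set ι => D ⊆ X ∧ ((diagram P).induce D).Connected) C

/-- A set of pairwise orthogonal roots. -/
def IsOrthogonalSet (O : Set ι) : Prop :=
  O.Pairwise P.IsOrthogonal

/-- `O` is a moset in `X`: a maximal orthogonal subset of `X`. -/
def IsMoset (O X : Set ι) : Prop :=
  O ⊆ X ∧ IsOrthogonalSet P O ∧ ∀ i ∈ X \ O, ¬ ∀ j ∈ O, P.IsOrthogonal i j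

/-- `O` is a perfect moset of `X`: it is contained in `X`, and for each irreducible component `C`
of `X` the set `O ∩ C` is a moset in `C` whose complement `C \ O` is orthogonal and has no more
elements than `O ∩ C`. -/
def IsPerfectMoset (O X : Set ι) : Prop :=
  O ⊆ X ∧ ∀ C : Set ι, IsComponent P C X →
    IsMoset P (O ∩ C) C ∧ IsOrthogonalSet P (C \ O) ∧ (C \ O).ncard ≤ (O ∩ C).ncard

/-- The charge of `Λ` is `n`: perfect mosets of `Λ` exist and all have `n` elements. -/
def HasCharge (Λ : Set ι) (n : ℕ) : Prop :=
  (∃ O, IsPerfectMoset P O Λ) ∧ ∀ O, IsPerfectMoset P O Λ → O.ncard = n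

/-! ### Parity in `E₇`

In the rest `α : Fin 7 → M` lists the simple roots `α₁, …, α₇` of `E₇` in Bourbaki's numbering
(`α 0 = α₁`, …, `α 6 = α₇`). -/

/-- The seven roots of the standard moset of `E₇`: the simple roots `α₂, α₃, α₅, α₇` and, up to
sign, the roots `ℓ₁, ℓ₃, ℓ₄` of the enhanced basis (the highest roots of the subsystems of type
`D₄`, `D₆`, `E₇` with simple roots `α₂, …, α₅`, `α₂, …, α₇` and `α₁, …, α₇`). In the tetrahedron
with vertices `α₁, α₄, α₆, ℓ₂` that represents the enhanced Dynkin diagram, `ℓ₁` is the center and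
the other six roots are the midpoints of the edges:
`α₃ = {α₁, α₄}`, `α₅ = {α₄, α₆}`, `ℓ₃ = {α₁, α₆}`,
`α₇ = {α₆, ℓ₂}`, `ℓ₄ = {α₁, ℓ₂}`, `α₂ = {α₄, ℓ₂}`. -/
def mosetRoot (α : Fin 7 → M) : Fin 7 → M :=
  ![α 1,
    α 2,
    α 4,
    α 6,
    α 1 + α 2 + 2 • α 3 + α 4,
    α 1 + α 2 + 2 • α 3 + 2 • α 4 + 2 • α 5 + α 6,
    2 • α 0 + 2 • α 1 + 3 • α 2 + 4 • α 3 + 3 • α 4 + 2 • α 5 + α 6]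

/-- The labels, in the same order: the seven nonzero vectors of `𝔽₂³`. The center of the
tetrahedron has label `111`, and three labels sum to zero exactly if the three nodes are the
midpoints of the edges of a face or lie on a line through the center. -/
def mosetLabel : Fin 7 → (Fin 3 → ZMod 2) :=
  ![![0, 0, 1],
    ![1, 0, 0],
    ![0, 1, 0],
    ![0, 1, 1],
    ![1, 1, 1],
    ![1, 1, 0],
    ![1, 0, 1]]

/-- The subset of the standard moset that consists of its roots numbered by `K`. -/
def mosetSubset (α : Fin 7 → M) (K : Finset (Fin 7)) : Set ι :=
  {i | ∃ k ∈ K, P.root i = mosetRoot α k}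

/-- The parity of a subset of the standard moset: `0` if its labels sum to the zero vector, and `1`
otherwise. -/
def labelParity (K : Finset (Fin 7)) : ℕ :=
  if ∑ k ∈ K, mosetLabel k = 0 then 0 else 1

/-- The orthogonal set `O` has parity `ε`: it is conjugate to a subset of the standard moset, and
each such subset has parity `ε`. -/
def OrthogonalSetHasParity (α : Fin 7 → M) (O : Set ι) (ε : ℕ) : Prop :=
  (∃ K, Conj P O (mosetSubset P α K)) ∧
    ∀ K, Conj P O (mosetSubset P α K) → labelParity K = ε

/-- `Λ` has parity `ε`: perfect mosets of `Λ` exist and all have parity `ε`. -/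
def HasParity (α : Fin 7 → M) (Λ : Set ι) (ε : ℕ) : Prop :=
  (∃ O, IsPerfectMoset P O Λ) ∧
    ∀ O, IsPerfectMoset P O Λ → OrthogonalSetHasParity P α O ε

end General

end PiSystems

/-!
The proof is a classification of all `Π`-systems of `E₇` up to the Weyl group, in which the
combinatorial part is carried out on explicit coordinates and checked by the kernel.

*Coordinates.* A root `∑ aₖ αₖ` is coded by the integer whose signed decimal digits are
`a₁ a₂ … a₇`. The codes form an explicit list of 126 integers, and pairings and reflections become
arithmetic (`PiSystems.coding`).

*Classification.* A `Π`-system is linearly independent and its pairings are non-positive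
(`IsPiSystem.isObtuse`); this property passes to subsets and to conjugates. So all `Π`-systems are
found by adding one root at a time. Let `R` be a representative of an orbit and `v` a root that may
be added to it. The reflections in the roots orthogonal to `R` fix `R`, hence `v` may be assumed
antidominant for them. This leaves few extensions `R ∪ {v}`, and for each of them a product of
reflections onto a representative is listed (`E7.table`, `E7.settled_table`). The outcome is that
every `Π`-system is conjugate to one of finitely many representatives (`Coding.exists_rep`).
A numerical isomorphism invariant (`isoInv`) takes different values on these representatives, except
that the two representatives of each of the six types of the theorem have the same value
(`E7.eq_or_special_of_inv_eq`). Hence all other `Π`-systems are normal, and the `Π`-systems of each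
of the six types form at most two orbits.

*Charge and parity.* In a `Π`-system of one of the six types all components are of type `Aₙ` with
`n` odd. Such a system has exactly one perfect moset: the first, third,
fifth, … root of each component (`IsTypeEquiv.isPerfectMoset_iff`). The representatives are chosen so that this moset is
contained in the standard moset. The parity of a subset of the standard moset is `0` if and only if
the sum of its roots has even pairing with all roots (`hasEvenSum_mosetSubset_iff`), a condition that
is invariant under the Weyl group. So the two representatives of a type, which have different
parity, are not conjugate, and the parity of a `Π`-system is well defined.
-/

namespace PiSystems

/-! ### Integer codes for the roots of `E₇` -/

namespace E7

/-- The signed decimal digit of `n` at `10 ^ k`: the digits of `-n` are the negatives of those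
of `n`. -/
def digit (n : ℤ) (k : ℕ) : ℤ := (n.tdiv (10 ^ k)).tmod 10

/-- The bilinear form of `E₇` on codes. The code of the root `∑ aₖ αₖ` is the integer with the
signed decimal digits `a₁ a₂ … a₇`, as in Bourbaki's tables. -/
def pr (m n : ℤ) : ℤ :=
  digit m 6 * (2 * digit n 6 - digit n 4) +
  digit m 5 * (2 * digit n 5 - digit n 3) +
  digit m 4 * (2 * digit n 4 - digit n 6 - digit n 3) +
  digit m 3 * (2 * digit n 3 - digit n 5 - digit n 4 - digit n 2) +
  digit m 2 * (2 * digit n 2 - digit n 3 - digit n 1) +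
  digit m 1 * (2 * digit n 1 - digit n 2 - digit n 0) +
  digit m 0 * (2 * digit n 0 - digit n 1)

/-- The codes of the positive roots. -/
def posRoots : List ℤ := [
    1000000, 100000, 10000, 1000, 100, 10, 1, 1010000, 101000, 11000, 1100, 110, 11, 1011000,
    111000, 101100, 11100, 1110, 111, 1111000, 1011100, 111100, 101110, 11110, 1111, 1111100,
    1011110, 112100, 111110, 101111, 11111, 1112100, 1111110, 1011111, 112110, 111111, 1122100,
    1112110, 1111111, 112210, 112111, 1122110, 1112210, 1112111, 112211, 1122210, 1122111,
    1112211, 112221, 1123210, 1122211, 1112221, 1223210, 1123211, 1122221, 1223211, 1123221,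
    1223221, 1123321, 1223321, 1224321, 1234321, 2234321]

/-- The codes of all roots. -/
def roots : List ℤ := posRoots ++ posRoots.map (- ·)

/-- The reflection in the root with code `g`. -/
def reflect (g n : ℤ) : ℤ := n - pr n g * g

/-- Product of reflections, the head of the list being applied first. -/
def act (w : List ℤ) (n : ℤ) : ℤ := w.foldl (fun n g => reflect g n) n

/-- Repeated subtraction from `y` of elements of `S` that have pairing `1` with it ends in `S`, as
it does for a positive root `y` of the subsystem with simple roots `S`. -/
def descends (S : List ℤ) : ℕ → ℤ → Bool
  | 0, _ => false
  | k + 1, y => S.contains y ||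
      match S.find? (fun r => pr y r == 1) with
      | some r => descends S k (y - r)
      | none => false

/-- A criterion for linear dependence: some `x ∈ X` is the negative of a positive root of the
subsystem spanned by the other elements. If the pairings in `X` are non-positive, then a dependent
`X` contains an extended Dynkin diagram, and each vertex with mark `1` of this diagram is such
an `x`. The fuel `20` exceeds the height of all roots, which is at most `17`. -/
def dependent (X : List ℤ) : Bool :=
  X.any fun x => descends (X.filter (· != x)) 20 (-x)

set_option maxHeartbeats 2000000 in
/-- Representatives `R` of the orbits of `Π`-systems. Each comes with pairs `(v, w)` such that the
product `w` of reflections maps `R ∪ {v}` onto another representative. Here `v` runs through the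
roots that are antidominant for the roots orthogonal to `R` and extend `R` to a linearly independent
set with non-positive pairings. -/
def table : List (List ℤ × List (ℤ × List ℤ)) := [
    ([], [(-2234321, [])]),
    ([-2234321], [(-112221, []), (1000000, [])]),
    ([-2234321, -112221], [(1011110, []), (1, [1111000, 1223321]), (10, [1011100, 1111000]),
    (1112221, [1122100, 2234321]), (-1, [1111000, 1223321, 1]), (-112100, [1010000, 1234321, 110,
    112110])]),
    ([-2234321, 1000000], [(1122100, []), (-101111, [11110]), (10000, [1000000, 1234321, 112100,
    11110, 111111])]),
    ([10000, 100, 1], [(-1223321, []), (-1122211, []), (2234321, []), (-111100, [112100]),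
    (-2234321, [2234321]), (100000, [1000000, 1224321]), (-1234321, [11000, 1100]), (-1223211,
    [110, 11]), (-111111, [112111, 112210]), (-100000, [1000000, 1224321, 100000]), (-112211,
    [11110, 1111, 112100]), (112100, [101000, 11000, 1000000, 1122221]), (112221, [11110, 1111,
    1000000, 1224321]), (-112100, [101000, 11000, 1000000, 1122221, 100]), (-112221, [1011000,
    1223221, 1112110, 1122210, 100])]),
    ([100000, 100, 1], [(-1223321, [1224321]), (-2234321, [2234321]), (-1122211, [1123211,
    1223210]), (-1223211, [110, 11, 1224321])]),
    ([-2234321, -112221, 1011110], [(11, []), (1223221, [1000000, 2234321, 1223221]), (101110,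
    [11, 112221, 101110]), (-11100, [10, 11111, 1011000, 1122100]), (101111, [1122100, 2234321,
    1000000, 1011110]), (1111111, [11, 112211, 1123221, 1112100, 1112221]), (1223210, [1011000,
    1224321, 11, 101110, 101100]), (1, [1111000, 1223321, 110, 11, 1010000]), (100000, [101000,
    1100, 1111110, 101111, 11111, 1122100])]),
    ([-2234321, 1000000, 1122100], [(11110, []), (10, [10000, 112100, 101000]), (1, [1011000,
    1224321, 111000]), (-1, [1011000, 1224321, 111000, 1]), (1122221, [1112110, 1000000, 1122110,
    110]), (-101100, [1011000, 1224321, 11100, 101110, 11110])]),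
    ([10000, 1000, 100, 1], [(2234321, []), (-112211, [112221]), (-2234321, [2234321]),
    (-1123321, [100000, 112100]), (-1234321, [11000, 1100]), (-112100, [1123211, 1011110]),
    (-1011111, [100000, 112111, 112210]), (-11111, [11000, 1100, 11110, 1111]), (112221, [101110,
    11110, 1000000, 1122100]), (-1223211, [11110, 1111, 11000, 1100]), (-112221, [101111, 11111,
    1112221, 1234321]), (100000, [11000, 1100, 1111111, 112100, 1111110]), (-1123211, [1110,
    111000, 1111110, 11, 101110])]),
    ([10000, 100, 1, 2234321], [(-111100, [112100]), (-1223321, [1000000, 1224321]), (-111111,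
    [112111, 112210]), (112100, [101000, 11000, 112100]), (-112211, [11110, 1111, 112100]),
    (-1234321, [112100, 1123221, 1111000]), (-1223211, [1000000, 1224321, 110, 11]), (-100000,
    [1000, 101100, 1111110, 1123210]), (112221, [10, 112111, 101110, 11110]), (-112100, [1112100,
    1234321, 1011000, 1223221]), (100000, [101000, 1100, 1011110, 1223210, 100000]), (-112221,
    [110, 11, 1100, 111100, 100000])]),
    ([100000, 1000, 100, 1], [(-1112211, [1112221]), (-2234321, [2234321]), (-1223211, [1223221,
    1123321]), (-1224321, [1123211, 101100, 1112111, 110, 1011110])]),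
    ([100000, 100, 1, 2234321], [(-112100, []), (-111100, [112100]), (112100, [112100]), (-10000,
    [101000, 1100]), (-112221, [110, 11]), (-111111, [112111, 112210]), (10000, [101000, 1100,
    112100]), (112221, [110, 11, 112100]), (-112211, [101110, 1111, 112100]), (-1122211,
    [1011000, 1223221, 1112100, 1112221]), (-1234321, [11100, 1223321, 2234321, 1112100]),
    (-1223211, [101000, 11000, 112100, 1011000, 1223221]), (-1223321, [101110, 101100, 112111,
    11110, 1011000, 1223221])]),
    ([10000, 100, 1, -1223321], [(-11111, []), (-112100, []), (-1123211, []), (-11100, []),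
    (112100, [112100]), (2234321, [1000000, 1224321]), (100000, [1000000, 1224321]), (1110,
    [11110, 1111]), (-1122100, [11110, 1111]), (10, [11110, 1111]), (1011110, [1, 1123210,
    1011110]), (1000000, [1011000, 1112211, 1122210]), (1111110, [1122210, 1112211, 1011000]),
    (1112221, [1123321, 1011000, 1111100]), (101110, [1110, 1011000, 111000, 1000]), (112221,
    [11110, 1111, 1000000, 1224321]), (1123221, [1000000, 1224321, 1000, 100, 101100]),
    (-1011100, [1000000, 1224321, 1000, 100, 11100]), (1112110, [112110, 1110, 1122211, 1223210,
    1000]), (1111000, [1000, 100, 1111000, 101111, 1223210, 1112221])]),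
    ([-2234321, 1000000, 1122100, 11110], [(111111, []), (1, [1011000, 1224321, 11100]),
    (1223221, [10, 1111000, 1011111, 1112210, 1100]), (100000, [1011000, 1224321, 11100, 101111,
    1223210, 1234321]), (11, [1011100, 1223321, 100000, 112100, 101110, 1223210]), (101110,
    [1011100, 1223321, 11110, 100000, 10000, 101111]), (-1100, [1011100, 1223321, 111110,
    1223211, 1111, 1112100, 1011110])]),
    ([-2234321, -112221, 1011110, 11], [(-11000, [1011000, 10, 1000000, 1010000]), (101110,
    [1011000, 1112110, 10, 1122100]), (1112211, [1112210, 111100, 1223321, 1111000]), (112211,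
    [1111000, 1223321, 100, 110, 1010000]), (1223210, [1011110, 1223221, 1011000, 111, 1224321]),
    (101100, [101000, 1010000, 1234321, 1, 1111111, 1223210]), (1223321, [1011000, 1224321, 10,
    101100, 111000, 1111000]), (100, [1011100, 1223321, 101110, 1111, 1122221, 1122100]),
    (100000, [1111100, 1100, 1112111, 10000, 11110, 1011111])]),
    ([10000, 100, 1, -1122211], [(-112100, []), (112100, [112100]), (-100000, [11000, 1100]),
    (-112221, [110, 11]), (100000, [11000, 1100, 112100]), (112221, [110, 11, 112100]), (1011000,
    [111100, 112210, 1011111, 1112210, 1100]), (1000000, [111110, 10, 11000, 1111110, 1011111]),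
    (1011110, [1110, 1100, 112111, 1010000, 1112221, 1111])]),
    ([10000, 1000, 100, 10, 1], [(2234321, []), (-2234321, [2234321]), (-1234321, [11000,
    1122221, 1111100, 1011000, 1100]), (100000, [1110, 112100, 1112210, 1122211, 101110]),
    (-112221, [10000, 11111, 1122211, 1112210, 11110, 111111]), (-1123321, [1000, 1234321, 1100,
    10000, 1112100, 1010000]), (-1011111, [101000, 1112211, 100000, 111111, 1010000, 1123210])]),
    ([10000, 1000, 100, 1, 2234321], [(-112221, []), (100000, []), (-112211, [112221]), (112221,
    [112221]), (-112100, [111000, 101100]), (-11111, [101100, 112221, 111000]), (-1123321,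
    [1011110, 1223210, 112221]), (-1011111, [1000, 1234321, 1100, 1010000, 10000]), (-1234321,
    [11110, 1223221, 101111, 1112210, 1111000]), (-1223211, [100000, 112111, 112210, 100,
    1223221, 1011100])]),
    ([100000, 1000, 100, 10, 1], [(-2234321, [2234321]), (-1112221, [111110, 1111100, 101110,
    1123321, 101100]), (-1224321, [11111, 1010000, 11000, 1122100, 1123321, 10])]),
    ([100000, 1000, 100, 1, 2234321], [(10000, []), (-112211, [112221]), (-1223211, [10000,
    1111100, 1223221, 111110]), (-112100, [101000, 1100, 10000, 112100]), (-101111, [101000,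
    1100, 101110, 1111]), (-112221, [101111, 11111, 1011110, 1223210]), (-1234321, [100000,
    1112111, 1122110, 1111110, 1123210]), (-1112221, [100000, 1112111, 1122110, 1123210,
    1223211]), (112221, [1011110, 1223210, 1000000, 1122100, 112221]), (-1112211, [100000,
    101111, 1122211, 1112210, 111111, 101000, 112210]), (-1224321, [101000, 11000, 100, 1223210,
    1111111, 112100, 1123321])]),
    ([100000, 100, 1, 2234321, -112100], [(112221, []), (-112221, [112221]), (1000, [111000,
    11100]), (-10000, [1112100, 1234321]), (10000, [1112100, 1234321, 112221]), (-1122211,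
    [1123211, 1223210, 111000, 11100]), (-1223321, [1224321, 1000000, 1111000, 1011100]),
    (-111111, [101000, 11000, 112110, 112211, 100]), (-111, [110, 11, 112100, 111110, 11111]),
    (-1122221, [1011000, 1123321, 101000, 11000, 100])]),
    ([10000, 100, 1, -1223321, -11111], [(-1011100, []), (1112221, []), (-112100, [1000000,
    1122100]), (-1122100, [11110, 1111]), (112100, [1000000, 1122100, 10000]), (2234321, [100,
    1011000, 1223321]), (10, [1112211, 1122210, 1011000]), (1011110, [100, 1223221, 1111000,
    1011100, 1123221]), (1123221, [1110, 1011000, 111000, 1000, 1011111, 1224321]), (112221,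
    [111100, 2234321, 112111, 1011110, 112110, 1223321, 101000])]),
    ([-2234321, 1000000, 1122100, 11110, 111111], [(1111, []), (101110, [100000, 1]), (1000,
    [1011100, 1223321, 1110, 1223210, 112221]), (101000, [1011100, 1223321, 111110, 1223211, 1]),
    (-100, [111110, 1000, 111000, 1111100, 1123321]), (100, [10, 112210, 111110, 2234321,
    1111000, 1123221])]),
    ([10000, 100, 1, -1223321, -112100], [(1112110, []), (-1011111, []), (-11111, [1000000,
    1122100]), (112110, [1000000, 1122100]), (-1010000, [11110, 1111]), (101000, [1011110,
    1123211]), (1123210, [1011110, 1123211]), (2234321, [1000000, 1224321, 112221]), (1223210,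
    [111100, 11000, 1123321]), (112221, [1112100, 1234321, 10000]), (1112100, [1000000, 1122100,
    11110, 1111]), (1111000, [1000, 1234321, 100, 1111000]), (1110, [11110, 1111, 1000000,
    1122100]), (1224321, [100, 1223221, 10, 112111, 1111000]), (101110, [100, 1223221, 1111000,
    1011100, 1123221]), (100000, [1224321, 101111, 11111, 1223211, 1]), (-1011100, [1000000,
    1224321, 1000, 100, 11100, 112221]), (1123221, [1000, 1234321, 11, 112211, 112100,
    1223211])]),
    ([10000, 100, 1, -1223321, -1123211], [(1110, []), (1000000, []), (112100, [112100]),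
    (-1010000, [1000000, 10000]), (1011110, [1, 1011110]), (1112110, [1, 1123211]), (101000,
    [110, 11, 100000]), (112221, [110, 11, 100000, 112100]), (1111000, [111, 1011100, 1223211,
    1111000]), (2234321, [1123221, 1111000, 1000000, 1224321]), (1123221, [1000000, 1224321,
    1000, 100, 101100]), (1223210, [1000000, 1224321, 110, 11, 1000, 100]), (1224321, [100,
    1223221, 1111000, 1011100, 1123221, 112100]), (1112100, [10, 1111000, 100, 1223321, 1111110,
    1011111]), (1112221, [10, 1123321, 111, 1223221, 1011110, 112110, 1111000]), (112110, [11000,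
    1122211, 1123210, 1011111, 1223211, 10, 1])]),
    ([10000, 100, 1, -1122211, -112100], [(1011000, [2234321]), (100000, [1123211, 1223210]),
    (-100000, [1123211, 1223210, 1]), (1123210, [101111, 10, 11000, 1010000, 1112221]), (112221,
    [1112100, 1234321, 101110, 111111, 10000]), (-112221, [1112100, 1234321, 11110, 1111,
    100000]), (1112100, [1010000, 1234321, 10, 11000, 111100, 101110])]),
    ([10000, 100, 1, -1223321, -11100], [(1123210, []), (112100, [1011110, 1123211, 1]),
    (-1011111, [110, 11, 100000, 112221]), (112110, [1011100, 1111000, 111100, 1122221]),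
    (2234321, [11110, 1111, 1000000, 1224321]), (112221, [11110, 1111, 1000000, 1224321]),
    (1123221, [1000, 1234321, 10, 1111000, 112111]), (1110, [100, 1223221, 1111000, 1011100,
    1123221]), (1223210, [11000, 1100, 10000, 1122221, 1234321]), (1011110, [110, 11, 100,
    1223221, 1123221, 1111000]), (1112100, [11100, 1110, 10000, 1000, 1000000, 1223210, 101111]),
    (-1010000, [11100, 1110, 10000, 1000, 1000000, 1223210, 11111])]),
    ([10000, 1000, 100, 10, 1, 2234321], [(100000, [112221]), (-112221, [11110, 1111, 112100,
    100000]), (-1234321, [10000, 1122221, 1000, 1111000, 1, 1123211]), (-1011111, [1111111,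
    1112211, 1223221, 1000000, 1111, 1122111])]),
    ([100000, 1000, 100, 10, 1, 2234321], [(10000, [112221]), (-112221, [101110, 1111, 112100,
    10000]), (-1000000, [100000, 1123321, 101000, 1123221, 1000000]), (-1234321, [100000,
    1123321, 101000, 1123221, 10000]), (-1112221, [111100, 10000, 1123211, 11100, 1122110]),
    (-1224321, [101000, 11000, 112100, 1223221, 100000, 1111000])]),
    ([-2234321, 1000000, 1122100, 11110, 111111, 1111], [(-100, [1011100, 1223321, 100000,
    112100, 11111, 101110]), (100, [1011100, 1223321, 100000, 112100, 11111, 101110, 2234321]),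
    (101000, [1000000, 1122221, 10000, 2234321, 111110, 1122210, 11110, 1111000])]),
    ([10000, 1000, 100, 1, 2234321, -112221], [(-1011111, [1000, 1234321, 1100, 1112100]),
    (101110, [11000, 1100, 101111, 111110]), (10, [11110, 1111, 112100, 100000]), (100000,
    [11110, 1111, 1122100, 1000000, 100000]), (-112100, [11110, 1111, 1122100, 1224321, 100000]),
    (-1223211, [1000, 1234321, 1100, 1112100, 1011110, 1123211]), (-1122100, [11000, 1100,
    101111, 111110, 1112100, 1112221]), (-1011100, [11110, 1111, 112100, 1112100, 1112221,
    100000])]),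
    ([10000, 100, 1, -1223321, -11111, -1011100], [(-112100, [1000000, 1122100]), (112100,
    [1000000, 1122100, 10000]), (1112221, [100000, 1112210, 1112111, 1122100]), (1011110, [1000,
    1112210, 112211, 1011111, 1010000])]),
    ([100000, 1000, 100, 1, 2234321, 10000], [(-112211, []), (-1234321, [1122110, 1112210]),
    (112221, [1123211, 1223210, 1112210, 1112111]), (-112221, [1123211, 112221, 1011110, 1122110,
    1112111])]),
    ([10000, 100, 1, -1223321, -1123211, 1110], [(1000000, [1122111, 1112211, 1111110]),
    (1111000, [111, 1011100, 1223211, 1111000]), (2234321, [1122100, 11110, 1123210, 11111]),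
    (101000, [112111, 100, 1011100, 1123210, 2234321]), (1223210, [110, 11, 101000, 1234321,
    1123321, 1123221]), (112100, [1111100, 1112221, 1110, 1122110, 111, 1223210])]),
    ([10000, 100, 1, -1223321, -112100, 1112110], [(100000, [1111110, 1011111, 2234321]),
    (-1011111, [112211, 110, 1111100]), (-1010000, [1000000, 1122100, 1112211, 1011000,
    1122210]), (112221, [1111110, 1011111, 2234321, 101110, 11110])]),
    ([10000, 100, 1, -1223321, -11111, 1112221], [(1123210, []), (112100, [1000000, 1122100,
    10000]), (-1010000, [10000, 1234321, 100000, 1122111, 1122210]), (-1011100, [110, 11, 100000,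
    1112221, 10000, 1112100])]),
    ([10000, 100, 1, -1223321, -112100, -1011111], [(1111000, []), (1224321, []), (112221, [100,
    1111100, 1223321]), (1112110, [112211, 110, 1111100]), (1112100, [1000, 1234321, 1111000,
    112100]), (2234321, [100000, 1112111, 1112210, 111000, 101100]), (1110, [1000, 1234321,
    10000, 1100, 10, 1123210, 112100]), (1123221, [100, 112111, 1111111, 100000, 1223221,
    1112100, 1112221, 10000])]),
    ([100000, 100, 1, 2234321, -112100, 112221], [(-10000, []), (-1122211, []), (10000, [10000]),
    (-1122221, [10, 112210]), (-111111, [1011100, 1111000]), (1000, [1123211, 1223210])]),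
    ([10000, 100, 1, -1223321, -11100, 1123210], [(112221, [10, 112210, 1011100, 1123221,
    100000]), (-1011111, [100, 1223221, 1, 1011110, 10, 1111000, 112111, 1123210])]),
    ([10000, 100, 1, -1223321, -1123211, 1000000], [(1123221, []), (1223210, [110, 11, 100000]),
    (112221, [1011000, 1112211, 1122210]), (112100, [1111000, 111100, 1122221]), (101000,
    [1011110, 11111, 1122100]), (1110, [1122111, 1111110, 1112211])]),
    ([100000, 1000, 100, 1, 2234321, 10000, -112211], []),
    ([10000, 100, 1, -1223321, -1123211, 1000000, 1123221], []),
    ([100000, 100, 1, 2234321, -112100, 112221, -10000], []),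
    ([10000, 100, 1, -1223321, -112100, -1011111, 1111000], []),
    ([100000, 100, 1, 2234321, -112100, 112221, -1122211], []),
    ([10000, 100, 1, -1223321, -112100, -1011111, 1224321], []),
    ([10000, 100, 1, -1223321, -11111, 1112221, 1123210], [])]

/-- The representatives of the orbits of `Π`-systems. -/
def reps : List (List ℤ) := table.map Prod.fst

/-- Two lists have the same elements. -/
def sameElements (X Y : List ℤ) : Bool := X.all Y.contains && Y.all X.contains

/-- The extension `v :: R` of the representative `R` is settled: it is not an extension to an
independent set of roots with non-positive pairings, or a reflection fixing `R` lowers `v`, or a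
listed word maps it to a representative. -/
def settled (R : List ℤ) (cert : List (ℤ × List ℤ)) (v : ℤ) : Bool :=
  R.any (fun r => v == r || decide (0 < pr v r)) ||
  posRoots.any (fun g => R.all (fun r => pr r g == 0) && pr v g == 1) ||
  cert.any (fun c => c.1 == v && c.2.all roots.contains &&
    reps.any (sameElements ((v :: R).map (act c.2)))) ||
  dependent (v :: R)

/-- Every root is settled as an extension of every representative. This is the computation on which
the classification rests. -/
theorem settled_table : table.all (fun e => roots.all (settled e.1 e.2)) = true := by
  decide +kernel

/-- The invariant `isoInv` of the set of roots with codes in `R`. -/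
def inv (R : List ℤ) : ℤ :=
  (R.map fun l => (2 + (R.map fun m => pr l m * (R.map (pr m)).sum).sum) ^ 4).sum

end E7

open E7

/-! ### Coding the roots -/

namespace E7

theorem sum_digit_of_mem : ∀ n ∈ roots, ∑ k : Fin 7, digit n (6 - k) * 10 ^ (6 - (k : ℕ)) = n := by
  decide +kernel

theorem digit_refl_simple : ∀ n ∈ roots, ∀ k : Fin 7, reflect (10 ^ (6 - (k : ℕ))) n ∈ roots ∧
    ∀ l : Fin 7, digit (reflect (10 ^ (6 - (k : ℕ))) n) (6 - l) =
      digit n (6 - l) - pr n (10 ^ (6 - (k : ℕ))) * if l = k then 1 else 0 := by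
  decide +kernel

theorem simple_mem_roots : ∀ k : Fin 7, (10 ^ (6 - (k : ℕ)) : ℤ) ∈ roots ∧
    ∀ l : Fin 7, digit (10 ^ (6 - (k : ℕ))) (6 - l) = if l = k then 1 else 0 := by
  decide +kernel

theorem posRoots_pos : ∀ n ∈ posRoots, 0 < n := by
  decide +kernel

/-- Every positive root arises from simple roots by adding simple roots one at a time. -/
theorem exists_simple_of_mem_posRoots : ∀ n ∈ posRoots,
    ∃ k : Fin 7, n = 10 ^ (6 - (k : ℕ)) ∨ n - 10 ^ (6 - (k : ℕ)) ∈ posRoots ∧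
      pr (n - 10 ^ (6 - (k : ℕ))) (10 ^ (6 - (k : ℕ))) = -1 := by
  decide +kernel

theorem neg_mem_roots {n : ℤ} (h : n ∈ roots) : -n ∈ roots := by
  simp only [roots, List.mem_append, List.mem_map] at h ⊢
  rcases h with h | ⟨m, h, rfl⟩
  · exact Or.inr ⟨n, h, rfl⟩
  · exact Or.inl (by simpa using h)

theorem digit_neg (n : ℤ) (k : ℕ) : digit (-n) k = -digit n k := by
  simp [digit]

theorem pr_neg_left (m n : ℤ) : pr (-m) n = -pr m n := by
  simp only [pr, digit_neg]; ring

theorem pr_comm (m n : ℤ) : pr m n = pr n m := by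
  simp only [pr]; ring

theorem pr_eq_sum (m n : ℤ) :
    pr m n = ∑ k : Fin 7, ∑ l : Fin 7, digit m (6 - k) * (digit n (6 - l) * CartanMatrix.E₇ k l) := by
  simp [Fin.sum_univ_succ, CartanMatrix.E₇, pr]
  ring

end E7

variable {ι M N : Type*} [AddCommGroup M] [Module ℝ M] [AddCommGroup N] [Module ℝ N]

/-- An identification of the roots of `P` with the codes of the roots of `E₇`. -/
structure Coding (P : RootPairing ι ℝ M N) where
  /-- The code of a root. -/
  code : ι → ℤ
  injective : Function.Injective code
  code_mem (i : ι) : code i ∈ roots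
  exists_code {n : ℤ} (hn : n ∈ roots) : ∃ i, code i = n
  pairing_eq (i j : ι) : P.pairing i j = pr (code i) (code j)
  code_reflection (i j : ι) : code (P.reflectionPerm i j) = reflect (code i) (code j)

section Construction

variable {P : RootPairing ι ℝ M N} {b : P.Base} (e : Fin 7 ≃ b.support)

theorem linearIndependent_simple : LinearIndependent ℝ fun k => P.root (e k) := by
  have h := b.linearIndepOn_root
  exact (linearIndependent_equiv e).2 h

/-- `n` is a code of the root `i`: the coordinates of the root and of the coroot are the digits. -/
def IsCode (i : ι) (n : ℤ) : Prop :=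
  n ∈ roots ∧ P.root i = ∑ k : Fin 7, (digit n (6 - k) : ℝ) • P.root (e k) ∧
    P.coroot i = ∑ k : Fin 7, (digit n (6 - k) : ℝ) • P.coroot (e k)

theorem isCode_simple (k : Fin 7) : IsCode e (e k) (10 ^ (6 - (k : ℕ))) := by
  refine ⟨(simple_mem_roots k).1, ?_, ?_⟩ <;> simp [(simple_mem_roots k).2]

variable {e} [P.IsCrystallographic]
  (hE₇ : ∀ i j, b.cartanMatrix (e i) (e j) = CartanMatrix.E₇ i j)
include hE₇

theorem IsCode.pairing {i j : ι} {m n : ℤ} (hi : IsCode e i m) (hj : IsCode e j n) :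
    P.pairing i j = pr m n := by
  have h (k l : Fin 7) : P.pairing (e k) (e l) = CartanMatrix.E₇ k l := by
    rw [← hE₇, RootPairing.Base.cartanMatrix, RootPairing.Base.cartanMatrixIn_def,
      ← P.algebraMap_pairingIn ℤ]
    rfl
  rw [← P.root_coroot_eq_pairing, hi.2.1, hj.2.2, pr_eq_sum]
  push_cast
  simp only [map_sum, map_smul, LinearMap.sum_apply, LinearMap.smul_apply,
    P.root_coroot_eq_pairing, h, smul_eq_mul]
  simp only [Finset.mul_sum]
  rw [Finset.sum_comm]
  exact Finset.sum_congr rfl fun _ _ => Finset.sum_congr rfl fun _ _ => by ring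

theorem IsCode.reflection_simple {i : ι} {n : ℤ} (hi : IsCode e i n) (k : Fin 7) :
    IsCode e (P.reflectionPerm (e k) i) (reflect (10 ^ (6 - (k : ℕ))) n) := by
  obtain ⟨h, h'⟩ := digit_refl_simple n hi.1 k
  have hp := hi.pairing hE₇ (isCode_simple e k)
  have hp' := (isCode_simple e k).pairing hE₇ hi
  rw [pr_comm] at hp'
  refine ⟨h, ?_, ?_⟩
  · rw [P.root_reflectionPerm, P.reflection_apply_root, hp]
    simp only [h', Int.cast_sub, sub_smul, Finset.sum_sub_distrib, ← hi.2.1]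
    simp
  · rw [P.coroot_reflectionPerm, P.coreflection_apply_coroot, hp']
    simp only [h', Int.cast_sub, sub_smul, Finset.sum_sub_distrib, ← hi.2.2]
    simp

omit hE₇ [P.IsCrystallographic] in
theorem IsCode.reflection_self {i : ι} {n : ℤ} (hi : IsCode e i n) :
    IsCode e (P.reflectionPerm i i) (-n) := by
  refine ⟨neg_mem_roots hi.1, ?_, ?_⟩
  · rw [P.root_reflectionPerm, P.reflection_apply_self, hi.2.1]
    simp [digit_neg]
  · rw [P.coroot_reflectionPerm, P.coreflection_apply_self, hi.2.2]
    simp [digit_neg]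

theorem exists_isCode [Finite ι] [P.IsReduced] (i : ι) : ∃ n, IsCode e i n := by
  induction i using b.induction_reflect with
  | h₀ i h => exact ⟨_, h.choose_spec.reflection_self⟩
  | h₁ i hi =>
    obtain ⟨k, hk⟩ := e.surjective ⟨i, hi⟩
    exact ⟨_, by simpa [hk] using isCode_simple e k⟩
  | h₂ i j h hj =>
    obtain ⟨k, hk⟩ := e.surjective ⟨j, hj⟩
    exact ⟨_, by simpa [hk] using h.choose_spec.reflection_simple hE₇ k⟩

theorem exists_isCode_of_mem {n : ℤ} (hn : n ∈ roots) : ∃ i, IsCode e i n := by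
  have main : ∀ (N : ℕ) (n : ℤ), n ∈ posRoots → n ≤ N → ∃ i, IsCode e i n := by
    intro N
    induction N with
    | zero => exact fun n hn h => absurd (posRoots_pos n hn) (by simpa using h)
    | succ N ih =>
      intro n hn h
      obtain ⟨k, rfl | ⟨hk, hp⟩⟩ := exists_simple_of_mem_posRoots n hn
      · exact ⟨_, isCode_simple e k⟩
      · obtain ⟨i, hi⟩ := ih _ hk (by
          have : (0 : ℤ) < 10 ^ (6 - (k : ℕ)) := by positivity
          push_cast at h
          omega)
        have := hi.reflection_simple hE₇ k
        rw [E7.reflect, hp] at this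
        exact ⟨_, by simpa using this⟩
  simp only [roots, List.mem_append, List.mem_map] at hn
  rcases hn with hn | ⟨m, hn, rfl⟩
  · exact main n.toNat n hn (Int.self_le_toNat n)
  · obtain ⟨i, hi⟩ := main m.toNat m hn (Int.self_le_toNat m)
    exact ⟨_, hi.reflection_self⟩

omit hE₇ [P.IsCrystallographic] in
theorem IsCode.digit_eq {i : ι} {n : ℤ} (hi : IsCode e i n) {c : Fin 7 → ℤ}
    (hc : P.root i = ∑ k, (c k : ℝ) • P.root (e k)) (k : Fin 7) : digit n (6 - k) = c k := by
  have := Fintype.linearIndependent_iff.1 (linearIndependent_simple e)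
    (fun k => (digit n (6 - k) : ℝ) - c k) (by
      simp only [sub_smul, Finset.sum_sub_distrib, ← hc, ← hi.2.1, sub_self]) k
  exact_mod_cast sub_eq_zero.1 this

omit hE₇ [P.IsCrystallographic] in
theorem IsCode.unique {i : ι} {m n : ℤ} (hm : IsCode e i m) (hn : IsCode e i n) : m = n := by
  rw [← sum_digit_of_mem m hm.1, ← sum_digit_of_mem n hn.1]
  exact Finset.sum_congr rfl fun k _ => by rw [hm.digit_eq hn.2.1 k]

theorem IsCode.reflection {i j : ι} {m n l : ℤ} (hi : IsCode e i m)
    (hj : IsCode e j n) (hl : IsCode e (P.reflectionPerm i j) l) : l = reflect m n := by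
  have h : P.root (P.reflectionPerm i j) =
      ∑ k : Fin 7, ((digit n (6 - k) - pr n m * digit m (6 - k) : ℤ) : ℝ) • P.root (e k) := by
    rw [P.root_reflectionPerm, P.reflection_apply_root, hj.pairing hE₇ hi, hi.2.1, hj.2.1,
      Finset.smul_sum, ← Finset.sum_sub_distrib]
    exact Finset.sum_congr rfl fun k _ => by push_cast; rw [sub_smul, mul_smul]
  rw [E7.reflect, ← sum_digit_of_mem l hl.1, Finset.sum_congr rfl fun k _ => by
    rw [hl.digit_eq h k]]
  simp only [sub_mul, Finset.sum_sub_distrib, mul_assoc, ← Finset.mul_sum,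
    sum_digit_of_mem m hi.1, sum_digit_of_mem n hj.1]

/-- The coding of the roots by their coordinates with respect to the simple roots. -/
noncomputable def coding [Finite ι] [P.IsReduced] : Coding P where
  code i := (exists_isCode hE₇ i).choose
  injective i j h := by
    have hi := (exists_isCode hE₇ i).choose_spec
    have hj := (exists_isCode hE₇ j).choose_spec
    simp only at h
    rw [h] at hi
    exact P.root.injective (hi.2.1.trans hj.2.1.symm)
  code_mem i := (exists_isCode hE₇ i).choose_spec.1
  exists_code hn :=
    have ⟨i, hi⟩ := exists_isCode_of_mem hE₇ hn
    ⟨i, (exists_isCode hE₇ i).choose_spec.unique hi⟩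
  pairing_eq i j :=
    (exists_isCode hE₇ i).choose_spec.pairing hE₇ (exists_isCode hE₇ j).choose_spec
  code_reflection i j :=
    (exists_isCode hE₇ i).choose_spec.reflection hE₇ (exists_isCode hE₇ j).choose_spec
      (exists_isCode hE₇ _).choose_spec

theorem isCode_code [Finite ι] [P.IsReduced] (i : ι) : IsCode e i ((coding hE₇).code i) :=
  (exists_isCode hE₇ i).choose_spec

end Construction

/-! ### Conjugacy -/

section Conjugacy

variable {ι M N : Type*} [AddCommGroup M] [Module ℝ M] [AddCommGroup N] [Module ℝ N]
variable {P : RootPairing ι ℝ M N} {Λ Λ' Λ'' : Set ι}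

theorem Conj.refl (Λ : Set ι) : Conj P Λ Λ :=
  ⟨1, by rw [map_one]; exact Set.image_id Λ⟩

theorem Conj.symm (h : Conj P Λ Λ') : Conj P Λ' Λ := by
  obtain ⟨w, rfl⟩ := h
  refine ⟨w⁻¹, ?_⟩
  rw [← Set.image_comp, ← Equiv.Perm.coe_mul, ← map_mul, inv_mul_cancel, map_one]
  exact Set.image_id Λ

theorem Conj.trans (h : Conj P Λ Λ') (h' : Conj P Λ' Λ'') : Conj P Λ Λ'' := by
  obtain ⟨w, rfl⟩ := h
  obtain ⟨w', rfl⟩ := h'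
  refine ⟨w' * w, ?_⟩
  rw [← Set.image_comp, ← Equiv.Perm.coe_mul, ← map_mul]

theorem conj_reflection (i : ι) (Λ : Set ι) : Conj P Λ (P.reflectionPerm i '' Λ) := by
  have h : P.reflectionPerm i ∈ P.weylGroupToPerm.range := by
    rw [P.range_weylGroupToPerm]
    exact Subgroup.subset_closure ⟨i, rfl⟩
  obtain ⟨w, hw⟩ := h
  exact ⟨w, by rw [hw]⟩

theorem pairing_weylGroup (w : P.weylGroup) (i j : ι) :
    P.pairing (P.weylGroupToPerm w i) (P.weylGroupToPerm w j) = P.pairing i j := by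
  have h : P.weylGroupToPerm w ∈ Subgroup.closure (Set.range P.reflectionPerm) := by
    rw [← P.range_weylGroupToPerm]
    exact ⟨w, rfl⟩
  generalize P.weylGroupToPerm w = g at h ⊢
  induction h using Subgroup.closure_induction generalizing i j with
  | mem g hg =>
    obtain ⟨k, rfl⟩ := hg
    rw [P.pairing_reflectionPerm, P.reflectionPerm_self]
  | one => rfl
  | mul g g' _ _ h h' => rw [Equiv.Perm.mul_apply, Equiv.Perm.mul_apply, h, h']
  | inv g _ h => rw [← h, ← Equiv.Perm.mul_apply, ← Equiv.Perm.mul_apply, mul_inv_cancel]; rfl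

theorem Conj.iso (h : Conj P Λ Λ') : Iso P Λ Λ' := by
  obtain ⟨w, rfl⟩ := h
  exact ⟨(P.weylGroupToPerm w).image Λ, fun i j => pairing_weylGroup w i j⟩

theorem Iso.symm (h : Iso P Λ Λ') : Iso P Λ' Λ := by
  obtain ⟨f, hf⟩ := h
  exact ⟨f.symm, fun i j => by rw [← hf, f.apply_symm_apply, f.apply_symm_apply]⟩

theorem Iso.trans (h : Iso P Λ Λ') (h' : Iso P Λ' Λ'') : Iso P Λ Λ'' := by
  obtain ⟨f, hf⟩ := h
  obtain ⟨g, hg⟩ := h'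
  exact ⟨f.trans g, fun i j => by rw [← hf, ← hg]; rfl⟩

theorem Iso.hasType {t : List ℕ} (h : Iso P Λ Λ') (hΛ : HasType P Λ t) : HasType P Λ' t := by
  obtain ⟨f, hf⟩ := h
  obtain ⟨g, hg⟩ := hΛ
  exact ⟨g.trans f, fun x y => by rw [← hg, ← hf]; rfl⟩

theorem HasType.iso {t : List ℕ} (h : HasType P Λ t) (h' : HasType P Λ' t) : Iso P Λ Λ' := by
  obtain ⟨f, hf⟩ := h
  obtain ⟨g, hg⟩ := h'
  refine ⟨f.symm.trans g, fun i j => ?_⟩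
  rw [Equiv.trans_apply, Equiv.trans_apply, hg, ← hf, f.apply_symm_apply, f.apply_symm_apply]

/-- A linearly independent set of roots with non-positive pairings. -/
def IsObtuse (P : RootPairing ι ℝ M N) (Λ : Set ι) : Prop :=
  LinearIndepOn ℝ P.root Λ ∧ Λ.Pairwise fun i j => P.pairing i j ≤ 0

theorem IsObtuse.mono (h : IsObtuse P Λ') (hΛ : Λ ⊆ Λ') : IsObtuse P Λ :=
  ⟨h.1.mono hΛ, h.2.mono hΛ⟩

theorem IsObtuse.conj (h : IsObtuse P Λ) (h' : Conj P Λ Λ') : IsObtuse P Λ' := by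
  obtain ⟨w, rfl⟩ := h'
  refine ⟨?_, ?_⟩
  · apply LinearIndepOn.image_of_comp
    have hw : P.root ∘ P.weylGroupToPerm w = P.weylGroupRootRep w ∘ P.root :=
      funext fun i => (P.weylGroup_apply_root w i).symm
    rw [hw]
    refine h.1.map_injOn _ (Function.Injective.injOn fun x y hxy => ?_)
    exact smul_left_cancel w hxy
  · rintro _ ⟨i, hi, rfl⟩ _ ⟨j, hj, rfl⟩ hij
    rw [pairing_weylGroup]
    exact h.2 hi hj fun h => hij (by rw [h])

theorem exists_dual {Λ : Set ι} (h : LinearIndepOn ℝ P.root Λ) {i : ι} (hi : i ∈ Λ) :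
    ∃ f : M →ₗ[ℝ] ℝ, f (P.root i) = 1 ∧ ∀ j ∈ Λ, j ≠ i → f (P.root j) = 0 := by
  classical
  obtain ⟨f, hf⟩ := LinearMap.exists_extend
    ((Finsupp.lapply (⟨i, hi⟩ : Λ)).comp h.linearIndependent.repr)
  have key (j : Λ) : f (P.root j) = Finsupp.single j (1 : ℝ) ⟨i, hi⟩ := by
    have hj : P.root j ∈ Submodule.span ℝ (Set.range fun x : Λ => P.root x) :=
      Submodule.subset_span ⟨j, rfl⟩
    have := LinearMap.congr_fun hf ⟨_, hj⟩
    simp only [LinearMap.comp_apply, Submodule.subtype_apply] at this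
    rw [this, h.linearIndependent.repr_eq_single j ⟨_, hj⟩ rfl]
    rfl
  refine ⟨f, by rw [key ⟨i, hi⟩, Finsupp.single_eq_same], fun j hj hji => ?_⟩
  rw [key ⟨j, hj⟩, Finsupp.single_eq_of_ne]
  exact fun h => hji (congrArg Subtype.val h).symm

theorem IsPiSystem.isObtuse (h : IsPiSystem P Λ) : IsObtuse P Λ := by
  obtain ⟨Ψ, hΨ, hΛΨ, hΛ, hpos⟩ := h
  refine ⟨hΛ, fun i hi j hj hij => ?_⟩
  by_contra! hp
  obtain ⟨f, hf, hf'⟩ := exists_dual hΛ hi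
  obtain ⟨g, hg, hg'⟩ := exists_dual hΛ hj
  have nonneg {k : ι} {f : M →ₗ[ℝ] ℝ} (hf : f (P.root k) = 1)
      (hf' : ∀ j ∈ Λ, j ≠ k → f (P.root j) = 0) (x : M)
      (hx : x ∈ AddSubmonoid.closure (P.root '' Λ)) : 0 ≤ f x := by
    induction hx using AddSubmonoid.closure_induction with
    | mem x hx =>
      obtain ⟨l, hl, rfl⟩ := hx
      by_cases hlk : l = k
      · rw [hlk, hf]; exact zero_le_one
      · rw [hf' l hl hlk]
    | zero => rw [map_zero]
    | add x y _ _ hx hy => rw [map_add]; exact add_nonneg hx hy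
  -- the reflection of `α_i` in `α_j` has coefficients of both signs
  have hr : P.root (P.reflectionPerm j i) = P.root i - P.pairing i j • P.root j := by
    rw [P.root_reflectionPerm, P.reflection_apply_root]
  rcases hpos _ (hΨ j (hΛΨ hj) i (hΛΨ hi)) with h | h
  · have := nonneg hg hg' _ h
    rw [hr, map_sub, map_smul, hg, hg' i hi hij, smul_eq_mul] at this
    linarith
  · have := nonneg hf hf' _ h
    rw [hr, map_neg, map_sub, map_smul, hf, hf' j hj hij.symm, smul_eq_mul] at this
    linarith

/-- An isomorphism invariant of sets of roots: with `A` the Cartan matrix of `Λ`, the sum of the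
fourth powers of the entries of `A² 1 + 2`. The power and the shift are chosen so that the invariant
separates the types that occur in `E₇`. -/
noncomputable def isoInv (P : RootPairing ι ℝ M N) (Λ : Set ι) : ℝ :=
  ∑ᶠ i : Λ, (2 + ∑ᶠ j : Λ, P.pairing i j * ∑ᶠ k : Λ, P.pairing j k) ^ 4

theorem Iso.isoInv_eq (h : Iso P Λ Λ') : isoInv P Λ = isoInv P Λ' := by
  obtain ⟨f, hf⟩ := h
  simp only [isoInv, ← finsum_comp_equiv f, hf]

end Conjugacy

/-! ### Classification of the `Π`-systems -/

namespace E7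

theorem mem_roots_of_mem_reps : ∀ R ∈ reps, R.Nodup ∧ ∀ n ∈ R, n ∈ roots := by
  decide +kernel

theorem bound_of_mem_roots : ∀ n ∈ roots, -10000000 < n := by
  decide +kernel

end E7

namespace Coding

variable {ι M N : Type*} [AddCommGroup M] [Module ℝ M] [AddCommGroup N] [Module ℝ N]
variable {P : RootPairing ι ℝ M N} (c : Coding P)

/-- The set of roots with codes in `R`. -/
def toSet (R : List ℤ) : Set ι := {i | c.code i ∈ R}

theorem code_reflection_self (i : ι) : c.code (P.reflectionPerm i i) = -c.code i := by
  have h : pr (c.code i) (c.code i) = 2 := by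
    have := c.pairing_eq i i
    rw [P.pairing_same] at this
    exact_mod_cast this.symm
  rw [c.code_reflection, E7.reflect, h]
  ring

theorem image_toSet {R : List ℤ} (hR : ∀ n ∈ R, n ∈ roots) (i : ι) :
    P.reflectionPerm i '' c.toSet R = c.toSet (R.map (reflect (c.code i))) := by
  ext j
  simp only [toSet, Set.mem_image, Set.mem_ofPred_eq, List.mem_map]
  constructor
  · rintro ⟨k, hk, rfl⟩
    exact ⟨_, hk, (c.code_reflection i k).symm⟩
  · rintro ⟨n, hn, h⟩
    obtain ⟨k, rfl⟩ := c.exists_code (hR n hn)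
    exact ⟨k, hn, c.injective ((c.code_reflection i k).trans h)⟩

theorem conj_act {w : List ℤ} (hw : ∀ g ∈ w, g ∈ roots) {R : List ℤ} (hR : ∀ n ∈ R, n ∈ roots) :
    Conj P (c.toSet R) (c.toSet (R.map (act w))) := by
  induction w generalizing R with
  | nil =>
    have : act [] = id := rfl
    rw [this, List.map_id]
    exact Conj.refl _
  | cons g w ih =>
    obtain ⟨i, rfl⟩ := c.exists_code (hw g List.mem_cons_self)
    have h := conj_reflection (P := P) i (c.toSet R)
    rw [c.image_toSet hR] at h
    have h' := ih (fun g hg => hw g (List.mem_cons_of_mem _ hg))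
      (R := R.map (reflect (c.code i))) (by
        intro n hn
        obtain ⟨m, hm, rfl⟩ := List.mem_map.1 hn
        obtain ⟨j, rfl⟩ := c.exists_code (hR m hm)
        rw [← c.code_reflection]
        exact c.code_mem _)
    rw [List.map_map] at h'
    exact h.trans h'

theorem root_mem_span_of_descends {S : List ℤ} (hS : ∀ n ∈ S, n ∈ roots) {k : ℕ} {i : ι}
    (h : descends S k (c.code i) = true) :
    P.root i ∈ Submodule.span ℝ (P.root '' c.toSet S) := by
  induction k generalizing i with
  | zero => simp [descends] at h
  | succ k ih =>
    rw [descends, Bool.or_eq_true, List.contains_iff_mem] at h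
    rcases h with h | h
    · exact Submodule.subset_span ⟨i, h, rfl⟩
    · split at h
      · rename_i r hr
        obtain ⟨j, rfl⟩ := c.exists_code (hS r (List.mem_of_find?_eq_some hr))
        have hp : pr (c.code i) (c.code j) = 1 := by simpa using List.find?_some hr
        have hij := c.code_reflection j i
        rw [E7.reflect, hp, one_mul] at hij
        rw [← hij] at h
        have := ih h
        rw [P.root_reflectionPerm, P.reflection_apply_root] at this
        have hj : P.root j ∈ Submodule.span ℝ (P.root '' c.toSet S) :=
          Submodule.subset_span ⟨j, List.mem_of_find?_eq_some hr, rfl⟩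
        simpa using add_mem this (Submodule.smul_mem _ (P.pairing i j) hj)
      · simp at h

theorem not_linearIndepOn_of_dependent {X : List ℤ} (hX : ∀ n ∈ X, n ∈ roots)
    (h : dependent X = true) : ¬LinearIndepOn ℝ P.root (c.toSet X) := by
  rw [dependent, List.any_eq_true] at h
  obtain ⟨x, hx, h⟩ := h
  obtain ⟨i, rfl⟩ := c.exists_code (hX x hx)
  rw [← c.code_reflection_self] at h
  have := c.root_mem_span_of_descends (fun n hn => hX n (List.mem_of_mem_filter hn)) h
  rw [P.root_reflectionPerm, P.reflection_apply_self, neg_mem_iff] at this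
  intro hli
  rw [linearIndepOn_iff_notMem_span] at hli
  refine hli i hx (Submodule.span_mono (Set.image_mono fun j hj => ?_) this)
  have hj' := List.mem_filter.1 hj
  exact ⟨hj'.1, fun h => by simp [Set.mem_singleton_iff.1 h] at hj'⟩

/-- The induction is on the code of the added root, which a reflection in a positive root that fixes
`R` and has positive pairing with the added root makes smaller. -/
theorem exists_rep_of_cons {R : List ℤ} {cert : List (ℤ × List ℤ)} (hR : (R, cert) ∈ table)
    (i : ι) (hi : c.code i ∉ R) (h : IsObtuse P (c.toSet (c.code i :: R))) :
    ∃ R' ∈ reps, Conj P (c.toSet (c.code i :: R)) (c.toSet R') := by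
  have hRr := (mem_roots_of_mem_reps R (List.mem_map_of_mem hR)).2
  have hroots (j : ι) : ∀ n ∈ c.code j :: R, n ∈ roots := by
    intro n hn
    rcases List.mem_cons.1 hn with rfl | hn
    · exact c.code_mem j
    · exact hRr n hn
  obtain ⟨N, hN⟩ : ∃ N : ℕ, c.code i + 10000000 ≤ N := ⟨_, Int.self_le_toNat _⟩
  induction N generalizing i with
  | zero =>
    have := bound_of_mem_roots _ (c.code_mem i)
    exact absurd hN (by push_cast; omega)
  | succ N ih =>
    have hset := List.all_eq_true.1 (List.all_eq_true.1 settled_table _ hR) _ (c.code_mem i)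
    simp only [settled, Bool.or_eq_true, List.any_eq_true, Bool.and_eq_true, List.all_eq_true,
      beq_iff_eq, decide_eq_true_eq, List.contains_iff_mem] at hset
    rcases hset with ((⟨r, hr, h' | h'⟩ | ⟨g, hg, hgR, hvg⟩) | ⟨⟨u, w⟩, -, ⟨hu, hw⟩, R', hR', hs⟩) | hd
    · exact absurd (h' ▸ hr) hi
    · obtain ⟨j, rfl⟩ := c.exists_code (hRr r hr)
      have := h.2 (show i ∈ c.toSet _ from List.mem_cons_self)
        (show j ∈ c.toSet _ from List.mem_cons_of_mem _ hr) (fun h => hi (h ▸ hr))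
      simp only [c.pairing_eq] at this
      exact absurd h' (not_lt.2 (by exact_mod_cast this))
    · obtain ⟨j, rfl⟩ := c.exists_code (List.mem_append_left _ hg)
      have hcode : c.code (P.reflectionPerm j i) = c.code i - c.code j := by
        rw [c.code_reflection, E7.reflect, hvg, one_mul]
      have hfix : ∀ r ∈ R, reflect (c.code j) r = r := fun r hr => by
        rw [E7.reflect, hgR r hr, zero_mul, sub_zero]
      have hc : Conj P (c.toSet (c.code i :: R))
          (c.toSet (c.code (P.reflectionPerm j i) :: R)) := by
        have := conj_reflection (P := P) j (c.toSet (c.code i :: R))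
        rwa [c.image_toSet (hroots i), List.map_cons, ← c.code_reflection,
          List.map_congr_left hfix, List.map_id'] at this
      obtain ⟨R', hR', h'⟩ := ih (P.reflectionPerm j i) (fun hmem => hi (by
          have := hfix _ hmem
          rw [← c.code_reflection, P.reflectionPerm_self] at this
          rwa [this])) (h.conj hc) (by
          have := posRoots_pos _ hg
          push_cast at hN
          omega)
      exact ⟨R', hR', hc.trans h'⟩
    · refine ⟨R', hR', ?_⟩
      have := c.conj_act hw (hroots i)
      rwa [show c.toSet ((c.code i :: R).map (act w)) = c.toSet R' from ?_] at this
      ext j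
      simp only [sameElements, Bool.and_eq_true, List.all_eq_true, List.contains_iff_mem] at hs
      exact ⟨fun hj => hs.1 _ hj, fun hj => hs.2 _ hj⟩
    · exact absurd h.1 (c.not_linearIndepOn_of_dependent (hroots i) hd)

/-- Every linearly independent set of roots with non-positive pairings, in particular every
`Π`-system, is conjugate to one of the representatives. -/
theorem exists_rep [Finite ι] {Λ : Set ι} (h : IsObtuse P Λ) :
    ∃ R ∈ reps, Conj P Λ (c.toSet R) := by
  induction Λ, Λ.toFinite using Set.Finite.induction_on with
  | empty =>
    refine ⟨[], by decide +kernel, ?_⟩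
    rw [show c.toSet [] = ∅ by simp [toSet]]
    exact Conj.refl _
  | @insert a s ha _ ih =>
    obtain ⟨R, hR, w, hw⟩ := ih (h.mono (Set.subset_insert a s))
    obtain ⟨⟨R, cert⟩, hRt, rfl⟩ := List.mem_map.1 hR
    have hins : P.weylGroupToPerm w '' insert a s =
        c.toSet (c.code (P.weylGroupToPerm w a) :: R) := by
      rw [Set.image_insert_eq, hw]
      ext j
      simp [toSet, c.injective.eq_iff]
    have hc : Conj P (insert a s) (c.toSet (c.code (P.weylGroupToPerm w a) :: R)) := ⟨w, hins⟩
    obtain ⟨R', hR', h'⟩ := c.exists_rep_of_cons hRt (P.weylGroupToPerm w a) (fun hmem => by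
      have : P.weylGroupToPerm w a ∈ P.weylGroupToPerm w '' s := hw ▸ hmem
      rw [(P.weylGroupToPerm w).injective.mem_set_image] at this
      exact ha this) (h.conj hc)
    exact ⟨R', hR', hc.trans h'⟩

theorem finsum_toSet {R : List ℤ} (hR : R.Nodup) (hr : ∀ n ∈ R, n ∈ roots) (G : ℤ → ℤ) :
    ∑ᶠ i : c.toSet R, (G (c.code i) : ℝ) = ((R.map G).sum : ℤ) := by
  rw [← List.sum_toFinset G hR, Int.cast_sum, ← finsum_mem_coe_finset,
    ← finsum_set_coe_eq_finsum_mem]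
  refine finsum_eq_of_bijective
    (fun i => ⟨c.code i, List.mem_toFinset.2 i.2⟩ : c.toSet R → (R.toFinset : Set ℤ)) ⟨?_, ?_⟩
    fun _ => rfl
  · exact fun i j h => Subtype.ext (c.injective (congrArg Subtype.val h))
  · rintro ⟨n, hn⟩
    have hn' : n ∈ R := by simpa using hn
    obtain ⟨i, rfl⟩ := c.exists_code (hr n hn')
    exact ⟨⟨i, hn'⟩, rfl⟩

theorem isoInv_toSet {R : List ℤ} (hR : R ∈ reps) : isoInv P (c.toSet R) = inv R := by
  obtain ⟨h, hr⟩ := mem_roots_of_mem_reps R hR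
  have h₁ (n : ℤ) : ∑ᶠ k : c.toSet R, (pr n (c.code k) : ℝ) = ((R.map (pr n)).sum : ℤ) :=
    c.finsum_toSet h hr _
  have h₂ (n : ℤ) : ∑ᶠ j : c.toSet R, (pr n (c.code j) * (R.map (pr (c.code j))).sum : ℝ) =
      ((R.map fun m => pr n m * (R.map (pr m)).sum).sum : ℤ) := by
    rw [← c.finsum_toSet h hr]
    simp only [Int.cast_mul]
  simp only [isoInv, inv, c.pairing_eq, h₁, h₂]
  rw [← c.finsum_toSet h hr]
  push_cast
  rfl

end Coding

/-! ### Perfect mosets of sums of diagrams of type `A` -/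

section Perfect

/-- For odd `n`, the Dynkin diagram of type `Aₙ` has exactly one partition into an orthogonal set
and an orthogonal complement that is not larger: the vertices in the even and in the odd positions,
where positions are counted from `0`. -/
theorem eq_even_of_orthogonal {n : ℕ} (hn : n ∈ [1, 3, 5]) (S : Finset (Fin n))
    (hS : ∀ i ∈ S, ∀ j ∈ S, i ≠ j → CartanMatrix.A n i j = 0)
    (hS' : ∀ i ∉ S, ∀ j ∉ S, i ≠ j → CartanMatrix.A n i j = 0) (hcard : Sᶜ.card ≤ S.card) :
    S = Finset.univ.filter fun i : Fin n => Even (i : ℕ) := by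
  simp only [CartanMatrix.A, Matrix.of_apply] at hS hS'
  simp only [List.mem_cons, List.not_mem_nil, or_false] at hn
  rcases hn with rfl | rfl | rfl <;> revert S <;> decide +kernel

theorem even_orthogonal {n : ℕ} (hn : n ∈ [1, 3, 5]) :
    (∀ i j : Fin n, Even (i : ℕ) → Even (j : ℕ) → i ≠ j → CartanMatrix.A n i j = 0) ∧
    (∀ i j : Fin n, ¬Even (i : ℕ) → ¬Even (j : ℕ) → i ≠ j → CartanMatrix.A n i j = 0) ∧
    (∀ i : Fin n, ¬Even (i : ℕ) → ∃ j : Fin n, Even (j : ℕ) ∧ CartanMatrix.A n i j ≠ 0) ∧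
    (Finset.univ.filter fun i : Fin n => Even (i : ℕ))ᶜ.card ≤
      (Finset.univ.filter fun i : Fin n => Even (i : ℕ)).card := by
  simp only [CartanMatrix.A, Matrix.of_apply]
  simp only [List.mem_cons, List.not_mem_nil, or_false] at hn
  rcases hn with rfl | rfl | rfl <;> decide +kernel

theorem det_A_ne_zero {n : ℕ} (hn : n ∈ [1, 3, 5]) : (CartanMatrix.A n).det ≠ 0 := by
  simp only [List.mem_cons, List.not_mem_nil, or_false] at hn
  rcases hn with rfl | rfl | rfl <;> decide +kernel

theorem sumA_same (t : List ℕ) (k : Fin t.length) (i j : Fin (t.get k)) :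
    sumA t ⟨k, i⟩ ⟨k, j⟩ = CartanMatrix.A (t.get k) i j :=
  Matrix.blockDiagonal'_apply_eq _ _ _ _

theorem sumA_of_ne (t : List ℕ) {k l : Fin t.length} (h : k ≠ l) (i : Fin (t.get k))
    (j : Fin (t.get l)) : sumA t ⟨k, i⟩ ⟨l, j⟩ = 0 :=
  Matrix.blockDiagonal'_apply_ne _ _ _ h

theorem A_comm (n : ℕ) (i j : Fin n) : CartanMatrix.A n i j = CartanMatrix.A n j i := by
  simp only [CartanMatrix.A, Matrix.of_apply, eq_comm (a := i), or_comm]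

theorem sumA_comm (t : List ℕ) (x y : Σ k : Fin t.length, Fin (t.get k)) :
    sumA t x y = sumA t y x := by
  obtain ⟨k, i⟩ := x
  obtain ⟨l, j⟩ := y
  by_cases h : k = l
  · subst h
    rw [sumA_same, sumA_same, A_comm]
  · rw [sumA_of_ne t h, sumA_of_ne t (Ne.symm h)]

variable {ι M N : Type*} [AddCommGroup M] [Module ℝ M] [AddCommGroup N] [Module ℝ N]
variable {P : RootPairing ι ℝ M N} {Λ : Set ι} {t : List ℕ}

/-- `f` is a numbering of `Λ` that shows that `Λ` has type `t`. -/
def IsTypeEquiv (P : RootPairing ι ℝ M N) (t : List ℕ)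
    (f : (Σ k : Fin t.length, Fin (t.get k)) ≃ Λ) : Prop :=
  ∀ x y, P.pairing (f x) (f y) = (sumA t x y : ℝ)

/-- The elements of `Λ` in the even positions of the components, counted from `0`. -/
def evenPart (f : (Σ k : Fin t.length, Fin (t.get k)) ≃ Λ) : Set ι :=
  (fun x => (f x : ι)) '' {x | Even (x.2 : ℕ)}

variable {f : (Σ k : Fin t.length, Fin (t.get k)) ≃ Λ}

theorem ncard_evenPart : (evenPart f).ncard =
    (Finset.univ.filter fun x : Σ k : Fin t.length, Fin (t.get k) => Even (x.2 : ℕ)).card := by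
  have hinj : Function.Injective fun x => (f x : ι) := Subtype.val_injective.comp f.injective
  rw [evenPart, Set.ncard_image_of_injective _ hinj, ← Set.ncard_coe_finset, Finset.coe_filter]
  simp

namespace IsTypeEquiv

variable (hf : IsTypeEquiv P t f)
include hf

theorem isOrthogonal_iff (x y : Σ k : Fin t.length, Fin (t.get k)) :
    P.IsOrthogonal (f x) (f y) ↔ sumA t x y = 0 := by
  rw [RootPairing.IsOrthogonal, hf, hf, sumA_comm t y x, and_self, Int.cast_eq_zero]

theorem linearIndepOn (ht : ∀ n ∈ t, n ∈ [1, 3, 5]) : LinearIndepOn ℝ P.root Λ := by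
  have : LinearIndependent ℝ fun x => P.root (f x) := by
    rw [Fintype.linearIndependent_iff]
    rintro g hg ⟨l, i⟩
    have hdet : ((CartanMatrix.A (t.get l)).map (Int.cast : ℤ → ℝ)).det ≠ 0 := by
      have := det_A_ne_zero (ht _ (List.get_mem t l))
      have hmap := (Int.castRingHom ℝ).map_det (CartanMatrix.A (t.get l))
      rw [RingHom.mapMatrix_apply, Int.coe_castRingHom] at hmap
      rw [← hmap]
      exact Int.cast_ne_zero.2 this
    refine congrFun (Matrix.eq_zero_of_vecMul_eq_zero hdet (v := fun i => g ⟨l, i⟩) ?_) i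
    ext j
    have h := congrArg (fun v => P.toLinearMap v (P.coroot (f ⟨l, j⟩))) hg
    simp only [map_sum, map_smul, LinearMap.sum_apply, LinearMap.smul_apply,
      P.root_coroot_eq_pairing, hf _ _, map_zero, LinearMap.zero_apply, smul_eq_mul] at h
    rw [Fintype.sum_sigma, Finset.sum_eq_single l (fun k _ hk =>
      Finset.sum_eq_zero fun i _ => by rw [sumA_of_ne t hk, Int.cast_zero, mul_zero])
      (by simp)] at h
    simpa [Matrix.vecMul, dotProduct, sumA_same] using h
  exact (linearIndependent_equiv f).1 this

omit hf in
theorem injective_component (f : (Σ k : Fin t.length, Fin (t.get k)) ≃ Λ) (k : Fin t.length) :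
    Function.Injective fun i => (f ⟨k, i⟩ : ι) := fun i j h => by
  simpa using f.injective (Subtype.ext h)

/-- A connected subset of `Λ` lies in a single component. -/
theorem eq_of_connected {D : Set ι} (hD : D ⊆ Λ) (hc : ((diagram P).induce D).Connected)
    {x y : Σ k : Fin t.length, Fin (t.get k)} (hx : (f x : ι) ∈ D) (hy : (f y : ι) ∈ D) :
    x.1 = y.1 := by
  obtain ⟨p⟩ := hc.preconnected ⟨_, hx⟩ ⟨_, hy⟩
  have key : ∀ {u v : D}, ((diagram P).induce D).Walk u v →
      (f.symm ⟨u, hD u.2⟩).1 = (f.symm ⟨v, hD v.2⟩).1 := by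
    intro u v p
    induction p with
    | nil => rfl
    | @cons u v w h _ ih =>
      rw [← ih]
      by_contra hne
      have horth : P.IsOrthogonal u v := by
        have := (hf.isOrthogonal_iff (f.symm ⟨u, hD u.2⟩) (f.symm ⟨v, hD v.2⟩)).2
          (sumA_of_ne t hne _ _)
        simpa using this
      have hadj : (diagram P).Adj u v := h
      rw [diagram, SimpleGraph.fromRel_adj] at hadj
      rcases hadj.2 with h | h
      · exact h horth
      · exact h ⟨horth.2, horth.1⟩
  simpa using key p

theorem connected_component (ht : ∀ n ∈ t, n ∈ [1, 3, 5]) (k : Fin t.length) :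
    ((diagram P).induce (Set.range fun i => (f ⟨k, i⟩ : ι))).Connected := by
  have hpos : 0 < t.get k := by
    have := ht _ (List.get_mem t k)
    simp only [List.mem_cons, List.not_mem_nil, or_false] at this
    omega
  obtain ⟨n, hn⟩ : ∃ n, t.get k = n + 1 := ⟨_, (Nat.succ_pred_eq_of_pos hpos).symm⟩
  have hp : (SimpleGraph.pathGraph (t.get k)).Connected := by
    rw [hn]; exact SimpleGraph.pathGraph_connected n
  let φ : SimpleGraph.pathGraph (t.get k) →g
      (diagram P).induce (Set.range fun i => (f ⟨k, i⟩ : ι)) :=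
    { toFun := fun i => ⟨f ⟨k, i⟩, i, rfl⟩
      map_rel' := fun {i j} h => by
        rw [SimpleGraph.pathGraph_adj] at h
        change (diagram P).Adj _ _
        have hij : i ≠ j := by
          rintro rfl
          omega
        rw [diagram, SimpleGraph.fromRel_adj]
        refine ⟨fun h => hij (injective_component f k h), Or.inl ?_⟩
        change ¬P.IsOrthogonal (f ⟨k, i⟩) (f ⟨k, j⟩)
        rw [hf.isOrthogonal_iff, sumA_same, CartanMatrix.A, Matrix.of_apply, if_neg hij,
          if_pos h]
        norm_num }
  have hφ : Function.Surjective φ := by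
    rintro ⟨_, i, rfl⟩
    exact ⟨i, rfl⟩
  exact hp.map φ hφ

theorem isComponent_iff (ht : ∀ n ∈ t, n ∈ [1, 3, 5]) (C : Set ι) :
    IsComponent P C Λ ↔ ∃ k, C = Set.range fun i => (f ⟨k, i⟩ : ι) := by
  have hsub (k : Fin t.length) : (Set.range fun i => (f ⟨k, i⟩ : ι)) ⊆ Λ := by
    rintro _ ⟨i, rfl⟩
    exact (f _).2
  have hle {D : Set ι} (hD : D ⊆ Λ) (hc : ((diagram P).induce D).Connected) {k : Fin t.length}
      {i : Fin (t.get k)} (hi : (f ⟨k, i⟩ : ι) ∈ D) : D ⊆ Set.range fun i => (f ⟨k, i⟩ : ι) := by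
    intro j hj
    obtain ⟨⟨l, m⟩, hx⟩ := f.surjective ⟨j, hD hj⟩
    have hx' : (f ⟨l, m⟩ : ι) = j := congrArg Subtype.val hx
    obtain rfl : k = l := hf.eq_of_connected hD hc hi (hx' ▸ hj)
    exact ⟨m, hx'⟩
  constructor
  · intro hC
    obtain ⟨⟨x, hx⟩⟩ := hC.prop.2.nonempty
    obtain ⟨⟨k, i⟩, hi⟩ := f.surjective ⟨x, hC.prop.1 hx⟩
    have hi' : (f ⟨k, i⟩ : ι) = x := congrArg Subtype.val hi
    exact ⟨k, hC.eq_of_subset ⟨hsub k, hf.connected_component ht k⟩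
      (hle hC.prop.1 hC.prop.2 (hi' ▸ hx))⟩
  · rintro ⟨k, rfl⟩
    refine ⟨⟨hsub k, hf.connected_component ht k⟩, fun D hD hkD => ?_⟩
    have hc := (hf.connected_component ht k).nonempty
    obtain ⟨⟨_, i, rfl⟩⟩ := hc
    exact hle hD.1 hD.2 (hkD ⟨i, rfl⟩)

/-- A set of type `t` with odd components has exactly one perfect moset. -/
theorem isPerfectMoset_iff (ht : ∀ n ∈ t, n ∈ [1, 3, 5]) (O : Set ι) :
    IsPerfectMoset P O Λ ↔ O = evenPart f := by
  classical
  have horth {k : Fin t.length} {i j : Fin (t.get k)} :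
      P.IsOrthogonal (f ⟨k, i⟩) (f ⟨k, j⟩) ↔ CartanMatrix.A (t.get k) i j = 0 := by
    rw [hf.isOrthogonal_iff, sumA_same]
  have hdiff (O : Set ι) (k : Fin t.length) (S : Finset (Fin (t.get k)))
      (hS : ∀ i, i ∈ S ↔ (f ⟨k, i⟩ : ι) ∈ O) :
      (O ∩ Set.range fun i => (f ⟨k, i⟩ : ι)) = (fun i => (f ⟨k, i⟩ : ι)) '' S ∧
      ((Set.range fun i => (f ⟨k, i⟩ : ι)) \ O) =
        (fun i => (f ⟨k, i⟩ : ι)) '' (Sᶜ : Finset (Fin (t.get k))) := by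
    constructor
    · ext x
      constructor
      · rintro ⟨hx, i, rfl⟩
        exact ⟨i, (hS i).2 hx, rfl⟩
      · rintro ⟨i, hi, rfl⟩
        exact ⟨(hS i).1 hi, i, rfl⟩
    · ext x
      constructor
      · rintro ⟨⟨i, rfl⟩, hx⟩
        exact ⟨i, by simpa using fun h => hx ((hS i).1 h), rfl⟩
      · rintro ⟨i, hi, rfl⟩
        refine ⟨⟨i, rfl⟩, fun h => ?_⟩
        have hi' : i ∉ S := by simpa using hi
        exact hi' ((hS i).2 h)
  constructor
  · rintro ⟨hO, h⟩
    have key (k : Fin t.length) (i : Fin (t.get k)) : (f ⟨k, i⟩ : ι) ∈ O ↔ Even (i : ℕ) := by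
      obtain ⟨h₁, h₂, h₃⟩ := h _ ((hf.isComponent_iff ht _).2 ⟨k, rfl⟩)
      let S : Finset (Fin (t.get k)) := Finset.univ.filter fun i => (f ⟨k, i⟩ : ι) ∈ O
      obtain ⟨e₁, e₂⟩ := hdiff O k S fun i => by simp [S]
      have hinj := injective_component f k
      rw [e₁, e₂, Set.ncard_image_of_injective _ hinj, Set.ncard_image_of_injective _ hinj,
        Set.ncard_coe_finset, Set.ncard_coe_finset] at h₃
      have hS := eq_even_of_orthogonal (ht _ (List.get_mem t k)) S
        (fun i hi j hj hij => horth.1 (h₁.2.1 ⟨(Finset.mem_filter.1 hi).2, i, rfl⟩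
          ⟨(Finset.mem_filter.1 hj).2, j, rfl⟩ (hinj.ne hij)))
        (fun i hi j hj hij => horth.1 (h₂ ⟨⟨i, rfl⟩, fun h => hi (by simpa [S] using h)⟩
          ⟨⟨j, rfl⟩, fun h => hj (by simpa [S] using h)⟩ (hinj.ne hij)))
        h₃
      simpa [S] using Finset.ext_iff.1 hS i
    ext x
    constructor
    · intro hx
      obtain ⟨⟨k, i⟩, hi⟩ := f.surjective ⟨x, hO hx⟩
      have hi' : (f ⟨k, i⟩ : ι) = x := congrArg Subtype.val hi
      exact ⟨⟨k, i⟩, (key k i).1 (hi' ▸ hx), hi'⟩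
    · rintro ⟨⟨k, i⟩, hi, rfl⟩
      exact (key k i).2 hi
  · rintro rfl
    have key (k : Fin t.length) (i : Fin (t.get k)) :
        (f ⟨k, i⟩ : ι) ∈ evenPart f ↔ Even (i : ℕ) := by
      constructor
      · rintro ⟨x, hx, h⟩
        obtain rfl := f.injective (Subtype.ext h)
        exact hx
      · exact fun h => ⟨⟨k, i⟩, h, rfl⟩
    refine ⟨by rintro _ ⟨x, -, rfl⟩; exact (f x).2, fun C hC => ?_⟩
    obtain ⟨k, rfl⟩ := (hf.isComponent_iff ht C).1 hC
    obtain ⟨h₁, h₂, h₃, h₄⟩ := even_orthogonal (ht _ (List.get_mem t k))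
    have hinj := injective_component f k
    refine ⟨⟨Set.inter_subset_right, ?_, ?_⟩, ?_, ?_⟩
    · rintro _ ⟨hi, i, rfl⟩ _ ⟨hj, j, rfl⟩ hij
      exact horth.2 (h₁ i j ((key k i).1 hi) ((key k j).1 hj) fun h => hij (by rw [h]))
    · rintro _ ⟨⟨i, rfl⟩, hi⟩ h
      obtain ⟨j, hj, hij⟩ := h₃ i fun h => hi ⟨(key k i).2 h, i, rfl⟩
      exact hij (horth.1 (h _ ⟨(key k j).2 hj, j, rfl⟩))
    · rintro _ ⟨⟨i, rfl⟩, hi⟩ _ ⟨⟨j, rfl⟩, hj⟩ hij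
      exact horth.2 (h₂ i j (fun h => hi ((key k i).2 h)) (fun h => hj ((key k j).2 h))
        fun h => hij (by rw [h]))
    · obtain ⟨e₁, e₂⟩ := hdiff (evenPart f) k (Finset.univ.filter fun i => Even (i : ℕ))
        fun i => by simp [key]
      rw [e₁, e₂, Set.ncard_image_of_injective _ hinj, Set.ncard_image_of_injective _ hinj,
        Set.ncard_coe_finset, Set.ncard_coe_finset]
      exact h₄

theorem hasCharge (ht : ∀ n ∈ t, n ∈ [1, 3, 5]) : HasCharge P Λ
    (Finset.univ.filter fun x : Σ k : Fin t.length, Fin (t.get k) => Even (x.2 : ℕ)).card := by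
  refine ⟨⟨_, (hf.isPerfectMoset_iff ht _).2 rfl⟩, fun O hO => ?_⟩
  rw [(hf.isPerfectMoset_iff ht O).1 hO, ncard_evenPart]

end IsTypeEquiv

end Perfect

/-! ### Special representatives -/

namespace E7

/-- The types of the special `Π`-systems, each with two representatives: the first one has
parity `0` and the second one has parity `1`. The elements of a representative are listed
component by component. -/
def special : List (List ℕ × List ℤ × List ℤ) := [
  ([5], [100000, 1000, 100, 10, 1], [10000, 1000, 100, 10, 1]),
  ([3, 1], [100000, 1000, 100, 1], [10000, 1000, 100, 1]),
  ([1, 1, 1], [100000, 100, 1], [10000, 100, 1]),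
  ([5, 1], [10000, 1000, 100, 10, 1, 2234321], [100000, 1000, 100, 10, 1, 2234321]),
  ([3, 1, 1], [10000, 1000, 100, 1, 2234321], [100000, 1000, 100, 1, 2234321]),
  ([1, 1, 1, 1], [10000, 100, 1, 2234321], [100000, 100, 1, 2234321])]

/-- The invariant `inv` separates the representatives of the non-special types from each other
and from the special ones. -/
theorem eq_or_special_of_inv_eq : ∀ R ∈ reps, ∀ S ∈ reps, inv R = inv S → R = S ∨
    ∃ s ∈ special, (R = s.2.1 ∨ R = s.2.2) ∧ (S = s.2.1 ∨ S = s.2.2) := by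
  decide +kernel

/-- The element of the list `R` in position `x`, when `R` lists its components, whose sizes are
given by `t`, one after the other. -/
def entry (t : List ℕ) (R : List ℤ) (x : Σ k : Fin t.length, Fin (t.get k)) : ℤ :=
  R.getD ((t.take x.1).sum + x.2) 0

/-- The entries in the even positions of the components. -/
def evenEntries (t : List ℕ) (R : List ℤ) : List ℤ :=
  R.filter fun n => ∃ x : Σ k : Fin t.length, Fin (t.get k), entry t R x = n ∧ Even (x.2 : ℕ)

/-- The entries of the Cartan matrix of type `t`. -/
def sumAEntry (t : List ℕ) (x y : Σ k : Fin t.length, Fin (t.get k)) : ℤ := sumA t x y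

/-- `R` has type `t` when its elements are numbered by `entry t R`. -/
def HasTypeList (t : List ℕ) (R : List ℤ) : Prop :=
  (∀ x, entry t R x ∈ R) ∧ (∀ n ∈ R, ∃ x, entry t R x = n) ∧
    (∀ x y, entry t R x = entry t R y → x = y) ∧
    ∀ x y, pr (entry t R x) (entry t R y) = sumAEntry t x y

instance (t : List ℕ) (R : List ℤ) : Decidable (HasTypeList t R) := by
  unfold HasTypeList
  infer_instance

theorem hasTypeList_special : ∀ s ∈ special, s.2.1 ∈ reps ∧ s.2.2 ∈ reps ∧
    HasTypeList s.1 s.2.1 ∧ HasTypeList s.1 s.2.2 ∧ ∀ n ∈ s.1, n ∈ [1, 3, 5] := by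
  decide +kernel

/-- The positive roots of height `h + 1` in the subsystem with simple roots `R`. -/
def level (R : List ℤ) : ℕ → List ℤ
  | 0 => R
  | h + 1 => ((level R h).flatMap fun x => (R.filter (pr x · == -1)).map (x + ·)).dedup

/-- The positive roots of height at most `5` in the subsystem with simple roots `R`. These are all of
its positive roots if its components are of type `Aₙ` with `n ≤ 5`. -/
def positive (R : List ℤ) : List ℤ := (List.range 5).flatMap (level R)

theorem positive_closed : ∀ s ∈ special, ∀ R ∈ [s.2.1, s.2.2], ∀ x ∈ positive R,
    ∀ y ∈ positive R, reflect x y ∈ positive R ∨ -reflect x y ∈ positive R := by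
  decide +kernel

/-- The codes of the roots of the standard moset. -/
def mosetCode : Fin 7 → ℤ := ![100000, 10000, 100, 1, 112100, 112221, 2234321]

theorem mosetCode_mem : ∀ k, mosetCode k ∈ roots := by
  decide +kernel

theorem mosetCode_injective : Function.Injective mosetCode := by
  decide +kernel

/-- The roots of the standard moset with labels `100`, `010`, `001`. -/
def labelBasis : Fin 3 → Fin 7 := ![1, 2, 0]

/-- Modulo `2`, the pairings of the elements of the standard moset with a root depend linearly
on the labels. -/
theorem pr_mosetCode : ∀ n ∈ roots, ∀ k, (pr (mosetCode k) n : ZMod 2) =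
    ∑ j, mosetLabel k j * (pr (mosetCode (labelBasis j)) n : ZMod 2) := by
  decide +kernel

theorem exists_pr_labelBasis : ∀ j, ∃ n ∈ roots,
    ∀ j', (pr (mosetCode (labelBasis j')) n : ZMod 2) = if j' = j then 1 else 0 := by
  decide +kernel

theorem exists_evenEntries : ∀ s ∈ special,
    (∃ K, labelParity K = 0 ∧ ∀ n, n ∈ evenEntries s.1 s.2.1 ↔ ∃ k ∈ K, mosetCode k = n) ∧
    (∃ K, labelParity K = 1 ∧ ∀ n, n ∈ evenEntries s.1 s.2.2 ↔ ∃ k ∈ K, mosetCode k = n) := by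
  have h : ∀ s ∈ special,
    (∃ K : Finset (Fin 7), labelParity K = 0 ∧
      (∀ n ∈ evenEntries s.1 s.2.1, ∃ k ∈ K, mosetCode k = n) ∧
      ∀ k ∈ K, mosetCode k ∈ evenEntries s.1 s.2.1) ∧
    (∃ K : Finset (Fin 7), labelParity K = 1 ∧
      (∀ n ∈ evenEntries s.1 s.2.2, ∃ k ∈ K, mosetCode k = n) ∧
      ∀ k ∈ K, mosetCode k ∈ evenEntries s.1 s.2.2) := by
    decide +kernel
  intro s hs
  obtain ⟨⟨K, h₀, h₁, h₂⟩, K', h₀', h₁', h₂'⟩ := h s hs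
  exact ⟨⟨K, h₀, fun n => ⟨h₁ n, by rintro ⟨k, hk, rfl⟩; exact h₂ k hk⟩⟩,
    ⟨K', h₀', fun n => ⟨h₁' n, by rintro ⟨k, hk, rfl⟩; exact h₂' k hk⟩⟩⟩

/-- A set of elements of the standard moset has parity `0` if and only if its sum has even pairing
with all roots. -/
theorem labelParity_eq_zero_iff (K : Finset (Fin 7)) :
    labelParity K = 0 ↔ ∀ n ∈ roots, ((∑ k ∈ K, pr (mosetCode k) n : ℤ) : ZMod 2) = 0 := by
  have key : ∀ n ∈ roots, ((∑ k ∈ K, pr (mosetCode k) n : ℤ) : ZMod 2) =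
      ∑ j, (∑ k ∈ K, mosetLabel k) j * (pr (mosetCode (labelBasis j)) n : ZMod 2) := by
    intro n hn
    push_cast
    rw [Finset.sum_congr rfl fun k _ => pr_mosetCode n hn k, Finset.sum_comm]
    exact Finset.sum_congr rfl fun j _ => by rw [Finset.sum_apply, Finset.sum_mul]
  rw [labelParity]
  constructor
  · intro h n hn
    split_ifs at h with h'
    rw [key n hn, h']
    simp
  · intro h
    rw [if_pos]
    ext j
    obtain ⟨n, hn, hj⟩ := exists_pr_labelBasis j
    have := key n hn
    rw [h n hn] at this
    simpa [hj] using this.symm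

theorem labelParity_eq_zero_or_one (K : Finset (Fin 7)) : labelParity K = 0 ∨ labelParity K = 1 := by
  rw [labelParity]
  split_ifs
  · exact Or.inl rfl
  · exact Or.inr rfl

end E7

namespace E7

/-- Sharper than `eq_or_special_of_inv_eq` in that `R` has the same type as the given pair. -/
theorem eq_of_inv_eq_special : ∀ s ∈ special, ∀ R ∈ reps, inv R = inv s.2.1 →
    R = s.2.1 ∨ R = s.2.2 := by
  decide +kernel

theorem evenCard_special : ∀ s ∈ special,
    (s.1 ∈ ([[5], [3, 1], [1, 1, 1]] : List (List ℕ)) ∧ (Finset.univ.filter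
      fun x : Σ k : Fin s.1.length, Fin (s.1.get k) => Even (x.2 : ℕ)).card = 3) ∨
    (s.1 ∈ ([[5, 1], [3, 1, 1], [1, 1, 1, 1]] : List (List ℕ)) ∧ (Finset.univ.filter
      fun x : Σ k : Fin s.1.length, Fin (s.1.get k) => Even (x.2 : ℕ)).card = 4) := by
  decide +kernel

theorem exists_special : ∀ t ∈ ([[5], [3, 1], [1, 1, 1], [5, 1], [3, 1, 1], [1, 1, 1, 1]] :
    List (List ℕ)), ∃ s ∈ special, s.1 = t := by
  decide +kernel

theorem reflect_neg_left (m n : ℤ) : reflect (-m) n = reflect m n := by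
  rw [reflect, reflect, pr_comm n, pr_neg_left, pr_comm m]
  ring

theorem reflect_neg_right (m n : ℤ) : reflect m (-n) = -reflect m n := by
  rw [reflect, reflect, pr_neg_left]
  ring

end E7

variable {ι M N : Type*} [AddCommGroup M] [Module ℝ M] [AddCommGroup N] [Module ℝ N]
variable {P : RootPairing ι ℝ M N}

namespace Coding

variable (c : Coding P)

theorem exists_typeEquiv {t : List ℕ} {R : List ℤ} (hR : ∀ n ∈ R, n ∈ roots)
    (h : HasTypeList t R) : ∃ f : (Σ k : Fin t.length, Fin (t.get k)) ≃ c.toSet R,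
      IsTypeEquiv P t f ∧ ∀ x, c.code (f x) = entry t R x := by
  obtain ⟨h₁, h₂, h₃, h₄⟩ := h
  choose g hg using fun x => c.exists_code (hR _ (h₁ x))
  let f : (Σ k : Fin t.length, Fin (t.get k)) → c.toSet R := fun x => ⟨g x, show c.code (g x) ∈ R from (hg x).symm ▸ h₁ x⟩
  have hf : Function.Bijective f := by
    refine ⟨fun x y hxy => h₃ x y ?_, fun ⟨i, hi⟩ => ?_⟩
    · rw [← hg, ← hg, show g x = g y from congrArg Subtype.val hxy]
    · obtain ⟨x, hx⟩ := h₂ _ hi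
      exact ⟨x, Subtype.ext (c.injective ((hg x).trans hx))⟩
  refine ⟨Equiv.ofBijective f hf, fun x y => ?_, hg⟩
  change P.pairing (g x) (g y) = _
  rw [c.pairing_eq, hg, hg, h₄]
  rfl

theorem evenPart_eq {t : List ℕ} {R : List ℤ} {f : (Σ k : Fin t.length, Fin (t.get k)) ≃ c.toSet R}
    (hf : ∀ x, c.code (f x) = entry t R x) : evenPart f = c.toSet (evenEntries t R) := by
  ext i
  simp only [evenPart, toSet, evenEntries, Set.mem_image, Set.mem_ofPred_eq, List.mem_filter,
    decide_eq_true_eq]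
  constructor
  · rintro ⟨x, hx, rfl⟩
    exact ⟨(f x).2, x, (hf x).symm, hx⟩
  · rintro ⟨-, x, hx, he⟩
    exact ⟨x, he, c.injective ((hf x).trans hx)⟩

theorem exists_of_mem_level {R : List ℤ} (hR : ∀ n ∈ R, n ∈ roots) {h : ℕ} {x : ℤ}
    (hx : x ∈ level R h) :
    ∃ i, c.code i = x ∧ P.root i ∈ AddSubmonoid.closure (P.root '' c.toSet R) := by
  induction h generalizing x with
  | zero =>
    obtain ⟨i, rfl⟩ := c.exists_code (hR x hx)
    exact ⟨i, rfl, AddSubmonoid.subset_closure ⟨i, hx, rfl⟩⟩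
  | succ h ih =>
    simp only [level, List.mem_dedup, List.mem_flatMap, List.mem_map, List.mem_filter,
      beq_iff_eq] at hx
    obtain ⟨y, hy, r, ⟨hr, hyr⟩, rfl⟩ := hx
    obtain ⟨i, rfl, hi⟩ := ih hy
    obtain ⟨j, rfl⟩ := c.exists_code (hR r hr)
    refine ⟨P.reflectionPerm j i, ?_, ?_⟩
    · rw [c.code_reflection, E7.reflect, hyr]
      ring
    · rw [P.root_reflectionPerm, P.reflection_apply_root, c.pairing_eq, hyr]
      simpa using add_mem hi (AddSubmonoid.subset_closure ⟨j, hr, rfl⟩)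

/-- If the roots in `positive R` and their negatives are stable under their own reflections, then
they form a subsystem with basis `R`. -/
theorem isPiSystem_toSet {R : List ℤ} (hR : ∀ n ∈ R, n ∈ roots)
    (hli : LinearIndepOn ℝ P.root (c.toSet R))
    (hcl : ∀ x ∈ positive R, ∀ y ∈ positive R,
      reflect x y ∈ positive R ∨ -reflect x y ∈ positive R) :
    IsPiSystem P (c.toSet R) := by
  have hpos {i : ι} (hi : c.code i ∈ positive R) :
      P.root i ∈ AddSubmonoid.closure (P.root '' c.toSet R) := by
    obtain ⟨h, -, hi⟩ := List.mem_flatMap.1 hi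
    obtain ⟨j, hj, hj'⟩ := c.exists_of_mem_level hR hi
    rwa [c.injective hj] at hj'
  refine ⟨{i | c.code i ∈ positive R ∨ -c.code i ∈ positive R}, ?_, ?_, hli, ?_⟩
  · intro i hi j hj
    change c.code _ ∈ _ ∨ -c.code _ ∈ _
    rw [c.code_reflection]
    rcases hi with hi | hi <;> rcases hj with hj | hj <;> have := hcl _ hi _ hj
    · exact this
    · rwa [reflect_neg_right, neg_neg, or_comm] at this
    · rwa [reflect_neg_left] at this
    · rwa [reflect_neg_left, reflect_neg_right, neg_neg, or_comm] at this
  · exact fun i hi => Or.inl (List.mem_flatMap.2 ⟨0, by simp, hi⟩)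
  · rintro i (hi | hi)
    · exact Or.inl (hpos hi)
    · refine Or.inr ?_
      rw [← c.code_reflection_self] at hi
      have := hpos hi
      rwa [P.root_reflectionPerm, P.reflection_apply_self] at this

end Coding

/-! ### Parity -/

/-- The sum of the elements of `O` has even pairing with every root. -/
def HasEvenSum (P : RootPairing ι ℝ M N) (O : Set ι) : Prop :=
  ∀ j, ∃ z : ℤ, ∑ᶠ i : O, P.pairing i j = 2 * z

theorem HasEvenSum.conj {O O' : Set ι} (h : HasEvenSum P O) (h' : Conj P O O') :
    HasEvenSum P O' := by
  obtain ⟨w, rfl⟩ := h'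
  intro j
  obtain ⟨j, rfl⟩ := (P.weylGroupToPerm w).surjective j
  obtain ⟨z, hz⟩ := h j
  refine ⟨z, ?_⟩
  rw [← hz, ← finsum_comp_equiv ((P.weylGroupToPerm w).image O)]
  exact finsum_congr fun i => pairing_weylGroup w i j

section Parity

variable {b : P.Base} {e : Fin 7 ≃ b.support} [P.IsCrystallographic] [P.IsReduced] [Finite ι]
  (hE₇ : ∀ i j, b.cartanMatrix (e i) (e j) = CartanMatrix.E₇ i j)

omit [P.IsCrystallographic] [P.IsReduced] [Finite ι] in
theorem mosetRoot_eq (k : Fin 7) : mosetRoot (fun i => P.root (e i)) k =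
    ∑ l : Fin 7, ((digit (mosetCode k) (6 - l) : ℤ) : ℝ) • P.root (e l) := by
  fin_cases k <;> simp [mosetRoot, mosetCode, Fin.sum_univ_succ, digit, add_assoc, ofNat_smul_eq_nsmul]

theorem root_eq_mosetRoot_iff (i : ι) (k : Fin 7) :
    P.root i = mosetRoot (fun i => P.root (e i)) k ↔ (coding hE₇).code i = mosetCode k := by
  have hi := isCode_code hE₇ i
  rw [mosetRoot_eq]
  constructor
  · intro h
    rw [← sum_digit_of_mem _ hi.1, ← sum_digit_of_mem _ (mosetCode_mem k)]
    exact Finset.sum_congr rfl fun l _ => by rw [hi.digit_eq h l]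
  · intro h
    rw [← h, ← hi.2.1]

theorem mosetSubset_eq_toSet (K : Finset (Fin 7)) :
    mosetSubset P (fun i => P.root (e i)) K = (coding hE₇).toSet (K.toList.map mosetCode) := by
  ext i
  simp only [mosetSubset, Coding.toSet, Set.mem_ofPred_eq, root_eq_mosetRoot_iff hE₇, List.mem_map,
    Finset.mem_toList, eq_comm]

include hE₇ in
theorem hasEvenSum_mosetSubset_iff (K : Finset (Fin 7)) :
    HasEvenSum P (mosetSubset P (fun i => P.root (e i)) K) ↔ labelParity K = 0 := by
  set c := coding hE₇ with hc
  have hsum (j : ι) : ∑ᶠ i : mosetSubset P (fun i => P.root (e i)) K, P.pairing i j =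
      ((∑ k ∈ K, pr (mosetCode k) (c.code j) : ℤ) : ℝ) := by
    rw [mosetSubset_eq_toSet hE₇, ← hc]
    simp only [c.pairing_eq]
    rw [c.finsum_toSet (K.nodup_toList.map mosetCode_injective) (by
      simp only [List.mem_map]
      rintro _ ⟨k, -, rfl⟩
      exact mosetCode_mem k) fun n => pr n (c.code j), List.map_map]
    exact congrArg _ (Finset.sum_map_toList K _)
  rw [labelParity_eq_zero_iff]
  simp only [HasEvenSum, hsum, ZMod.intCast_zmod_eq_zero_iff_dvd]
  constructor
  · intro h n hn
    obtain ⟨j, rfl⟩ := c.exists_code hn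
    obtain ⟨z, hz⟩ := h j
    exact ⟨z, by exact_mod_cast hz⟩
  · intro h j
    obtain ⟨z, hz⟩ := h _ (c.code_mem j)
    exact ⟨z, by exact_mod_cast hz⟩

theorem hasParity_of_conj {t : List ℕ} (ht : ∀ n ∈ t, n ∈ [1, 3, 5]) {R : List ℤ}
    (hR : ∀ n ∈ R, n ∈ roots) (h : HasTypeList t R) {ε : ℕ}
    (hK : ∃ K, labelParity K = ε ∧ ∀ n, n ∈ evenEntries t R ↔ ∃ k ∈ K, mosetCode k = n)
    {Λ : Set ι} (hΛ : Conj P ((coding hE₇).toSet R) Λ) :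
    HasParity P (fun i => P.root (e i)) Λ ε := by
  obtain ⟨K, hε, hK⟩ := hK
  obtain ⟨f, hf, hcode⟩ := (coding hE₇).exists_typeEquiv hR h
  obtain ⟨w, rfl⟩ := hΛ
  have heven : evenPart f = mosetSubset P (fun i => P.root (e i)) K := by
    rw [(coding hE₇).evenPart_eq hcode, mosetSubset_eq_toSet hE₇]
    ext i
    simp only [Coding.toSet, Set.mem_ofPred_eq, hK, List.mem_map, Finset.mem_toList]
  let f' := f.trans ((P.weylGroupToPerm w).image _)
  have hf' : IsTypeEquiv P t f' := fun x y => by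
    rw [← hf]
    exact pairing_weylGroup w _ _
  have heven' : Conj P (evenPart f) (evenPart f') := by
    refine ⟨w, ?_⟩
    rw [evenPart, evenPart, ← Set.image_comp]
    rfl
  refine ⟨⟨_, (hf'.isPerfectMoset_iff ht _).2 rfl⟩, fun O hO => ?_⟩
  rw [(hf'.isPerfectMoset_iff ht O).1 hO]
  rw [heven] at heven'
  refine ⟨⟨K, heven'.symm⟩, fun K' hK' => ?_⟩
  have hiff : labelParity K' = 0 ↔ labelParity K = 0 := by
    rw [← hasEvenSum_mosetSubset_iff hE₇, ← hasEvenSum_mosetSubset_iff hE₇]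
    exact ⟨fun h => h.conj (heven'.trans hK').symm, fun h => h.conj (heven'.trans hK')⟩
  rw [← hε]
  rcases labelParity_eq_zero_or_one K with h | h <;>
    rcases labelParity_eq_zero_or_one K' with h' | h' <;> simp_all

omit [P.IsCrystallographic] [P.IsReduced] [Finite ι] in
theorem HasParity.unique {α : Fin 7 → M} {Λ : Set ι} {ε ε' : ℕ} (h : HasParity P α Λ ε)
    (h' : HasParity P α Λ ε') : ε = ε' := by
  obtain ⟨⟨O, hO⟩, h⟩ := h
  obtain ⟨⟨K, hK⟩, hε⟩ := h O hO
  rw [← hε K hK, (h'.2 O hO).2 K hK]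

end Parity

namespace Coding

variable (c : Coding P)

theorem inv_eq_of_iso {R S : List ℤ} (hR : R ∈ reps) (hS : S ∈ reps)
    (h : Iso P (c.toSet R) (c.toSet S)) : inv R = inv S := by
  have := h.isoInv_eq
  rw [c.isoInv_toSet hR, c.isoInv_toSet hS] at this
  exact_mod_cast this

theorem hasType_toSet {t : List ℕ} {R : List ℤ} (hR : ∀ n ∈ R, n ∈ roots)
    (h : HasTypeList t R) : HasType P (c.toSet R) t := by
  obtain ⟨f, hf, -⟩ := c.exists_typeEquiv hR h
  exact ⟨f, hf⟩

include c in
/-- A special `Π`-system has one of the types listed in `special`. -/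
theorem exists_hasType_of_isSpecial [Finite ι] {Λ : Set ι} (h : IsSpecial P Λ) :
    ∃ s ∈ special, HasType P Λ s.1 := by
  obtain ⟨hΛ, hn⟩ := h
  obtain ⟨Λ', hΛ', hiso, hconj⟩ : ∃ Λ', IsPiSystem P Λ' ∧ Iso P Λ Λ' ∧ ¬Conj P Λ Λ' := by
    by_contra! hcon
    exact hn ⟨hΛ, hcon⟩
  obtain ⟨R, hR, hc⟩ := c.exists_rep hΛ.isObtuse
  obtain ⟨S, hS, hc'⟩ := c.exists_rep hΛ'.isObtuse
  rcases eq_or_special_of_inv_eq R hR S hS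
    (c.inv_eq_of_iso hR hS ((hc.iso.symm.trans hiso).trans hc'.iso)) with rfl | ⟨s, hs, h, -⟩
  · exact absurd (hc.trans hc'.symm) hconj
  · obtain ⟨-, -, h₀, h₁, -⟩ := hasTypeList_special s hs
    refine ⟨s, hs, hc.iso.symm.hasType (c.hasType_toSet (mem_roots_of_mem_reps R hR).2 ?_)⟩
    rcases h with rfl | rfl
    · exact h₀
    · exact h₁

/-- The `Π`-systems of a type listed in `special` form the orbits of the two representatives. -/
theorem orbitsOfType_special [Finite ι] {s : List ℕ × List ℤ × List ℤ} (hs : s ∈ special) :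
    orbitsOfType P s.1 =
      {{Λ | Conj P (c.toSet s.2.1) Λ}, {Λ | Conj P (c.toSet s.2.2) Λ}} := by
  obtain ⟨h₀, h₁, t₀, t₁, ht⟩ := hasTypeList_special s hs
  have hr {R : List ℤ} (hR : R ∈ reps) := (mem_roots_of_mem_reps R hR).2
  have hpi {R : List ℤ} (hR : R ∈ reps) (hR' : R ∈ [s.2.1, s.2.2]) (h : HasTypeList s.1 R) :
      IsPiSystem P (c.toSet R) := by
    obtain ⟨f, hf, -⟩ := c.exists_typeEquiv (hr hR) h
    exact c.isPiSystem_toSet (hr hR) (hf.linearIndepOn ht) (positive_closed s hs R hR')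
  ext Ω
  simp only [Set.mem_insert_iff, Set.mem_singleton_iff]
  constructor
  · rintro ⟨Λ, hΛ, hΛt, rfl⟩
    obtain ⟨R, hR, hc⟩ := c.exists_rep hΛ.isObtuse
    have horbit : {Λ' | Conj P Λ Λ'} = {Λ' | Conj P (c.toSet R) Λ'} :=
      Set.ext fun Λ' => ⟨fun h => hc.symm.trans h, fun h => hc.trans h⟩
    rw [horbit]
    rcases eq_of_inv_eq_special s hs R hR (c.inv_eq_of_iso hR h₀
      (hc.iso.symm.trans (hΛt.iso (c.hasType_toSet (hr h₀) t₀)))) with rfl | rfl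
    · exact Or.inl rfl
    · exact Or.inr rfl
  · rintro (rfl | rfl)
    · exact ⟨_, hpi h₀ (by simp) t₀, c.hasType_toSet (hr h₀) t₀, rfl⟩
    · exact ⟨_, hpi h₁ (by simp) t₁, c.hasType_toSet (hr h₁) t₁, rfl⟩

end Coding
end PiSystems

open PiSystems in
theorem theorem4p5 {ι M N : Type*} [Finite ι] [AddCommGroup M] [Module ℝ M]
    [AddCommGroup N] [Module ℝ N] (P : RootPairing ι ℝ M N)
    [P.IsRootSystem] [P.IsCrystallographic] [P.IsReduced]
    (b : P.Base) (e : Fin 7 ≃ b.support)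
    (hE₇ : ∀ i j, b.cartanMatrix (e i) (e j) = CartanMatrix.E₇ i j) :
    (∀ Λ : Set ι, IsSpecial P Λ →
      ((∃ t ∈ ([[5], [3, 1], [1, 1, 1]] : List (List ℕ)), HasType P Λ t) ∧ HasCharge P Λ 3) ∨
      ((∃ t ∈ ([[5, 1], [3, 1, 1], [1, 1, 1, 1]] : List (List ℕ)), HasType P Λ t) ∧
        HasCharge P Λ 4)) ∧
    ∀ t ∈ ([[5], [3, 1], [1, 1, 1], [5, 1], [3, 1, 1], [1, 1, 1, 1]] : List (List ℕ)),
      ∃ Ω₀ Ω₁ : Set (Set ι), Ω₀ ≠ Ω₁ ∧ orbitsOfType P t = {Ω₀, Ω₁} ∧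
        (∀ Λ ∈ Ω₀, HasParity P (fun i => P.root (e i)) Λ 0) ∧
        (∀ Λ ∈ Ω₁, HasParity P (fun i => P.root (e i)) Λ 1) := by
  refine ⟨fun Λ hΛ => ?_, fun t ht => ?_⟩
  · obtain ⟨s, hs, hΛs⟩ := (coding hE₇).exists_hasType_of_isSpecial hΛ
    obtain ⟨f, hf⟩ := hΛs
    have hcharge := IsTypeEquiv.hasCharge (f := f) hf (E7.hasTypeList_special s hs).2.2.2.2
    rcases E7.evenCard_special s hs with ⟨h, hcard⟩ | ⟨h, hcard⟩
    · exact Or.inl ⟨⟨_, h, f, hf⟩, hcard ▸ hcharge⟩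
    · exact Or.inr ⟨⟨_, h, f, hf⟩, hcard ▸ hcharge⟩
  · obtain ⟨s, hs, rfl⟩ := E7.exists_special t ht
    obtain ⟨h₀, h₁, t₀, t₁, ht'⟩ := E7.hasTypeList_special s hs
    obtain ⟨k₀, k₁⟩ := E7.exists_evenEntries s hs
    have p₀ (Λ : Set ι) (hΛ : Conj P ((coding hE₇).toSet s.2.1) Λ) :
        HasParity P (fun i => P.root (e i)) Λ 0 :=
      hasParity_of_conj hE₇ ht' (E7.mem_roots_of_mem_reps _ h₀).2 t₀ k₀ hΛ
    have p₁ (Λ : Set ι) (hΛ : Conj P ((coding hE₇).toSet s.2.2) Λ) :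
        HasParity P (fun i => P.root (e i)) Λ 1 :=
      hasParity_of_conj hE₇ ht' (E7.mem_roots_of_mem_reps _ h₁).2 t₁ k₁ hΛ
    refine ⟨_, _, fun h => ?_, (coding hE₇).orbitsOfType_special hs, p₀, p₁⟩
    -- an orbit cannot have both parities
    have hmem : (coding hE₇).toSet s.2.1 ∈ {Λ | Conj P ((coding hE₇).toSet s.2.2) Λ} :=
      h ▸ Conj.refl (P := P) ((coding hE₇).toSet s.2.1)
    exact zero_ne_one ((p₀ _ (Conj.refl _)).unique (p₁ _ hmem))
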